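/- Setting. Let $\Theta$ be a Borel subset of a Polish space, $\mu$ a $\sigma$-finite measure on its Borel $\sigma$-algebra, and $\mathbb{G}$ a stochastic kernel on $\Theta$ such that for every $\ell\in\Theta$ the measure $\mathbb{G}(\ell,\cdot)$ has a density $g(\ell,\cdot)\ge 0$ with respect to $\mu$. Let $\mathcal{H}_\infty^{n\times m}$ be the set of measurable $\mu$-essentially bounded functions $\Theta\to\mathbb{R}^{n\times m}$, $\mathcal{SH}_\infty^{n}$ the set of symmetric-valued elements of $\mathcal{H}_\infty^{n\times n}$, and $\mathcal{H}_\infty^{n+}$ the set of positive semidefinite-valued ones. All pointwise (in)equalities are understood $\mu$-a.e., and $U\gg 0$ means that for some $\xi>0$, $U(\ell)\ge\xi I$ for $\mu$-almost all $\ell$; $P\le P'$ means $P'-P\in\mathcal{H}_\infty^{n+}$. Let $A\in\mathcal{H}_\infty^{n\times n}$, $G\in\mathcal{H}_\infty^{n\times m}$, $Q\in\mathcal{SH}_\infty^{n}$, and $R\in\mathcal{SH}_\infty^{m}$ with $R\gg 0$. For $S\in\mathcal{H}_\infty^{n\times n}$, the system $(S|\mathbb{G})$, $x(k+1)=S(\vartheta(k))x(k)$,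 is EMSS (exponentially mean-square stable) if there are $\beta\ge 1$ and $\alpha\in(0,1)$ such that $\mathbf{E}\|x(k)\|^2\le\beta\alpha^k\|x_0\|^2$ for all $k\in\mathbb{N}$, all deterministic $x(0)=x_0\in\mathbb{R}^n$ and every Markov chain $\vartheta$ with kernel $\mathbb{G}$ and initial distribution absolutely continuous with respect to $\mu$. A gain $K\in\mathcal{H}_\infty^{m\times n}$ exponentially stabilizes $(A,G|\mathbb{G})$ if $(A+GK|\mathbb{G})$ is EMSS, and $(A,G|\mathbb{G})$ is exponentially mean-square stabilizable if such a $K$ exists. $(S;C|\mathbb{G})$, with $C$ having $p$ rows, is detectable if $(S+HC|\mathbb{G})$ is EMSS for some $H\in\mathcal{H}_\infty^{n\times p}$. For $P\in\mathcal{SH}_\infty^{n}$ put $\mathcal{E}(P)(\ell)=\int_\Theta g(\ell,t)P(t)\,\mu(dt)$, $\mathcal{T}_S(P)=S^{T}\mathcal{E}(P)S$, $\mathcal{G}(P)=G^{T}\mathcal{E}(P)A$, $\mathcal{R}(P)=R+\mathcal{T}_G(P)$, $\mathcal{M}(P)=-\mathcal{R}(P)^{-1}\mathcal{G}(P)$,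 $\mathcal{W}(P)=-P+\mathcal{T}_A(P)+Q-\mathcal{G}(P)^{T}\mathcal{R}(P)^{-1}\mathcal{G}(P)$, and $\mathbf{S}_+=\{P\in\mathcal{SH}_\infty^{n}:\ \mathcal{R}(P)\gg 0,\ \mathcal{W}(P)\ge 0\}$. A solution of the coupled algebraic Riccati equations (coupled-AREs) is a $P\in\mathcal{SH}_\infty^{n}$ with $\mathcal{R}(P)$ invertible and $P=\mathcal{T}_A(P)+Q-\mathcal{G}(P)^{T}\mathcal{R}(P)^{-1}\mathcal{G}(P)$. A solution $P$ is maximal if $P'\le P$ for all $P'\in\mathbf{S}_+$, and stabilizing if $\mathcal{M}(P)$ exponentially stabilizes $(A,G|\mathbb{G})$. Theorem. The following assertions are equivalent: (i) $(A,G|\mathbb{G})$ is exponentially mean-square stabilizable and there exists $P\in\mathbf{S}_+$ such that $(A+G\mathcal{M}(P);\mathcal{W}(P)^{1/2}|\mathbb{G})$ is detectable, where $\mathcal{W}(P)^{1/2}$ is the pointwise positive semidefinite square root; (ii) the coupled-AREs have a stabilizing solution $P$ satisfying $\mathcal{R}(P)\gg 0$. In that case the maximal solution and the stabilizing solution both exist,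 each is unique up to $\mu$-null sets, they coincide $\mu$-a.e., and this solution satisfies $\mathcal{R}(P)\gg 0$. -/

import Mathlib

open MeasureTheory ProbabilityTheory Filter
open scoped ENNReal Matrix Matrix.Norms.L2Operator MatrixOrder

/-! Discrete-time Markov jump linear systems whose mode is a Markov chain on a standard Borel space,
and the associated coupled algebraic Riccati equations.

Matrix-valued functions are genuine functions on the mode space, and every pointwise property is
required `μ`-almost everywhere. The norm on matrices is the operator norm induced by the Euclidean
norms. -/

namespace MJLS

noncomputable section

variable {Θ : Type*} [MeasurableSpace Θ] {n m p : ℕ}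

/-! ### Spaces of matrix-valued functions -/

/-- The space `𝓗_∞` of measurable, `μ`-essentially bounded matrix-valued functions. -/
def HInf (μ : Measure Θ) (n m : ℕ) : Set (Θ → Matrix (Fin n) (Fin m) ℝ) :=
  {Q | (∀ i j, Measurable fun ℓ => Q ℓ i j) ∧ ∃ c : ℝ, ∀ᵐ ℓ ∂μ, ‖Q ℓ‖ ≤ c}

/-- The space `𝓢𝓗_∞` of symmetric elements of `𝓗_∞`. -/
def SHInf (μ : Measure Θ) (n : ℕ) : Set (Θ → Matrix (Fin n) (Fin n) ℝ) :=
  {Q | Q ∈ HInf μ n n ∧ ∀ᵐ ℓ ∂μ, (Q ℓ).IsSymm}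

/-- `Q(ℓ) ≥ 0` for `μ`-almost all `ℓ`. -/
def AENonneg (μ : Measure Θ) (Q : Θ → Matrix (Fin n) (Fin n) ℝ) : Prop :=
  ∀ᵐ ℓ ∂μ, (Q ℓ).PosSemidef

/-- `Q(ℓ) ≫ 0` for `μ`-almost all `ℓ`: for some `ξ > 0`, `Q(ℓ) ≥ ξ I` for `μ`-almost all `ℓ`. -/
def AEUniformPos (μ : Measure Θ) (Q : Θ → Matrix (Fin n) (Fin n) ℝ) : Prop :=
  ∃ ξ : ℝ, 0 < ξ ∧ ∀ᵐ ℓ ∂μ, (Q ℓ - ξ • (1 : Matrix (Fin n) (Fin n) ℝ)).PosSemidef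

/-! ### The Markov chain, the state, and stability -/

/-- The one-step transition kernels of the time-homogeneous chain with stochastic kernel `κ`,
as kernels depending on the past up to time `k` (only through its last coordinate). -/
def stepKernel (κ : Kernel Θ Θ) (k : ℕ) : Kernel ((_ : Finset.Iic k) → Θ) Θ :=
  κ.comap (fun h => h ⟨k, Finset.mem_Iic.2 le_rfl⟩) (measurable_pi_apply _)

/-- The law on path space `ℕ → Θ` of the Markov chain with initial distribution `μ₀` and
stochastic kernel `κ`. -/
def chainLaw (κ : Kernel Θ Θ) [IsMarkovKernel κ] (μ₀ : Measure Θ) [IsProbabilityMeasure μ₀] :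
    Measure (ℕ → Θ) :=
  haveI : ∀ k, IsMarkovKernel (stepKernel κ k) := fun k => by
    unfold stepKernel; infer_instance
  Kernel.trajMeasure (X := fun _ => Θ) μ₀ (stepKernel κ)

/-- The state at time `k` of `x(k+1) = A(ϑ(k)) x(k)`, `x(0) = x₀`, along the mode path `ϑ`. -/
def state (A : Θ → Matrix (Fin n) (Fin n) ℝ) (x₀ : EuclideanSpace ℝ (Fin n)) (ϑ : ℕ → Θ) :
    ℕ → EuclideanSpace ℝ (Fin n)
  | 0 => x₀
  | k + 1 => WithLp.toLp 2 (A (ϑ k) *ᵥ (state A x₀ ϑ k).ofLp)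

/-- Exponential mean-square stability of `x(k+1) = A(ϑ(k)) x(k)`: the bound
`E‖x(k)‖² ≤ β αᵏ ‖x₀‖²` holds for all deterministic `x₀` and all initial mode distributions `μ₀`
that are absolutely continuous with respect to `μ`. The expectation depends on the chain through
its law only, so it is taken on path space. -/
def EMSS (μ : Measure Θ) (κ : Kernel Θ Θ) [IsMarkovKernel κ]
    (A : Θ → Matrix (Fin n) (Fin n) ℝ) : Prop :=
  ∃ β α : ℝ, 1 ≤ β ∧ 0 < α ∧ α < 1 ∧
    ∀ (x₀ : EuclideanSpace ℝ (Fin n)) (μ₀ : Measure Θ) [IsProbabilityMeasure μ₀], μ₀ ≪ μ →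
      ∀ k : ℕ, ∫⁻ ϑ, ENNReal.ofReal (‖state A x₀ ϑ k‖ ^ 2) ∂(chainLaw κ μ₀) ≤
        ENNReal.ofReal (β * α ^ k * ‖x₀‖ ^ 2)

/-- The feedback `u(k) = K(ϑ(k)) x(k)` with gain `K ∈ 𝓗_∞` exponentially stabilizes
`x(k+1) = A(ϑ(k)) x(k) + G(ϑ(k)) u(k)`. -/
def ExpStabilizes (μ : Measure Θ) (κ : Kernel Θ Θ) [IsMarkovKernel κ]
    (A : Θ → Matrix (Fin n) (Fin n) ℝ) (G : Θ → Matrix (Fin n) (Fin m) ℝ)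
    (K : Θ → Matrix (Fin m) (Fin n) ℝ) : Prop :=
  K ∈ HInf μ m n ∧ EMSS μ κ fun ℓ => A ℓ + G ℓ * K ℓ

/-- Exponential mean-square stabilizability of `(A, G | 𝔾)`. -/
def Stabilizable (μ : Measure Θ) (κ : Kernel Θ Θ) [IsMarkovKernel κ]
    (A : Θ → Matrix (Fin n) (Fin n) ℝ) (G : Θ → Matrix (Fin n) (Fin m) ℝ) : Prop :=
  ∃ K, ExpStabilizes μ κ A G K

/-- Detectability of `(A; C | 𝔾)`. -/
def Detectable (μ : Measure Θ) (κ : Kernel Θ Θ) [IsMarkovKernel κ]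
    (A : Θ → Matrix (Fin n) (Fin n) ℝ) (C : Θ → Matrix (Fin p) (Fin n) ℝ) : Prop :=
  ∃ H ∈ HInf μ n p, EMSS μ κ fun ℓ => A ℓ + H ℓ * C ℓ

/-! ### The Riccati operators

`g` is the transition density with respect to `μ`. -/

/-- `𝓔(U)(ℓ) = ∫ g(ℓ,t) U(t) μ(dt)`, computed entrywise. -/
def opE (μ : Measure Θ) (g : Θ → Θ → ℝ) (U : Θ → Matrix (Fin n) (Fin n) ℝ) :
    Θ → Matrix (Fin n) (Fin n) ℝ :=
  fun ℓ => Matrix.of fun i j => ∫ t, g ℓ t * U t i j ∂μ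

/-- `𝓣_Q(U)(ℓ) = Q(ℓ)ᵀ 𝓔(U)(ℓ) Q(ℓ)`. -/
def opT (μ : Measure Θ) (g : Θ → Θ → ℝ) (Q : Θ → Matrix (Fin n) (Fin m) ℝ)
    (U : Θ → Matrix (Fin n) (Fin n) ℝ) : Θ → Matrix (Fin m) (Fin m) ℝ :=
  fun ℓ => (Q ℓ)ᵀ * opE μ g U ℓ * Q ℓ

/-- `𝓖(P)(ℓ) = G(ℓ)ᵀ 𝓔(P)(ℓ) A(ℓ)`. -/
def opG (μ : Measure Θ) (g : Θ → Θ → ℝ) (A : Θ → Matrix (Fin n) (Fin n) ℝ)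
    (G : Θ → Matrix (Fin n) (Fin m) ℝ) (P : Θ → Matrix (Fin n) (Fin n) ℝ) :
    Θ → Matrix (Fin m) (Fin n) ℝ :=
  fun ℓ => (G ℓ)ᵀ * opE μ g P ℓ * A ℓ

/-- `𝓡(P)(ℓ) = R(ℓ) + 𝓣_G(P)(ℓ)`. -/
def opR (μ : Measure Θ) (g : Θ → Θ → ℝ) (G : Θ → Matrix (Fin n) (Fin m) ℝ)
    (R : Θ → Matrix (Fin m) (Fin m) ℝ) (P : Θ → Matrix (Fin n) (Fin n) ℝ) :
    Θ → Matrix (Fin m) (Fin m) ℝ :=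
  fun ℓ => R ℓ + opT μ g G P ℓ

/-- `𝓜(P)(ℓ) = -𝓡(P)(ℓ)⁻¹ 𝓖(P)(ℓ)`. -/
def opM (μ : Measure Θ) (g : Θ → Θ → ℝ) (A : Θ → Matrix (Fin n) (Fin n) ℝ)
    (G : Θ → Matrix (Fin n) (Fin m) ℝ) (R : Θ → Matrix (Fin m) (Fin m) ℝ)
    (P : Θ → Matrix (Fin n) (Fin n) ℝ) : Θ → Matrix (Fin m) (Fin n) ℝ :=
  fun ℓ => -((opR μ g G R P ℓ)⁻¹ * opG μ g A G P ℓ)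

/-- The right-hand side of the coupled Riccati equations,
`𝓣_A(P)(ℓ) + Q(ℓ) - 𝓖(P)(ℓ)ᵀ 𝓡(P)(ℓ)⁻¹ 𝓖(P)(ℓ)`. -/
def riccatiRHS (μ : Measure Θ) (g : Θ → Θ → ℝ) (A : Θ → Matrix (Fin n) (Fin n) ℝ)
    (G : Θ → Matrix (Fin n) (Fin m) ℝ) (Q : Θ → Matrix (Fin n) (Fin n) ℝ)
    (R : Θ → Matrix (Fin m) (Fin m) ℝ) (P : Θ → Matrix (Fin n) (Fin n) ℝ) :
    Θ → Matrix (Fin n) (Fin n) ℝ :=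
  fun ℓ => opT μ g A P ℓ + Q ℓ -
    (opG μ g A G P ℓ)ᵀ * (opR μ g G R P ℓ)⁻¹ * opG μ g A G P ℓ

/-- `𝓦(P)(ℓ) = -P(ℓ) + 𝓣_A(P)(ℓ) + Q(ℓ) - 𝓖(P)(ℓ)ᵀ 𝓡(P)(ℓ)⁻¹ 𝓖(P)(ℓ)`. -/
def opW (μ : Measure Θ) (g : Θ → Θ → ℝ) (A : Θ → Matrix (Fin n) (Fin n) ℝ)
    (G : Θ → Matrix (Fin n) (Fin m) ℝ) (Q : Θ → Matrix (Fin n) (Fin n) ℝ)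
    (R : Θ → Matrix (Fin m) (Fin m) ℝ) (P : Θ → Matrix (Fin n) (Fin n) ℝ) :
    Θ → Matrix (Fin n) (Fin n) ℝ :=
  fun ℓ => -P ℓ + riccatiRHS μ g A G Q R P ℓ

/-- The pointwise positive semidefinite square root of a matrix-valued function. -/
def sqrtFun (W : Θ → Matrix (Fin n) (Fin n) ℝ) : Θ → Matrix (Fin n) (Fin n) ℝ :=
  fun ℓ => CFC.sqrt (W ℓ)

/-- The sign condition `𝓡(P)(ℓ) ≫ 0` for `μ`-almost all `ℓ`. -/
def SignCondition (μ : Measure Θ) (g : Θ → Θ → ℝ) (G : Θ → Matrix (Fin n) (Fin m) ℝ)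
    (R : Θ → Matrix (Fin m) (Fin m) ℝ) (P : Θ → Matrix (Fin n) (Fin n) ℝ) : Prop :=
  AEUniformPos μ (opR μ g G R P)

/-- The set `𝐒₊` of `P ∈ 𝓢𝓗_∞` with `𝓡(P) ≫ 0` and `𝓦(P) ≥ 0`. -/
def SPlus (μ : Measure Θ) (g : Θ → Θ → ℝ) (A : Θ → Matrix (Fin n) (Fin n) ℝ)
    (G : Θ → Matrix (Fin n) (Fin m) ℝ) (Q : Θ → Matrix (Fin n) (Fin n) ℝ)
    (R : Θ → Matrix (Fin m) (Fin m) ℝ) : Set (Θ → Matrix (Fin n) (Fin n) ℝ) :=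
  {P | P ∈ SHInf μ n ∧ SignCondition μ g G R P ∧ AENonneg μ (opW μ g A G Q R P)}

/-- `P ∈ 𝓢𝓗_∞` solves the coupled Riccati equations. The inverse `𝓡(P)(ℓ)⁻¹` in the equation
is required to exist. -/
def IsSolution (μ : Measure Θ) (g : Θ → Θ → ℝ) (A : Θ → Matrix (Fin n) (Fin n) ℝ)
    (G : Θ → Matrix (Fin n) (Fin m) ℝ) (Q : Θ → Matrix (Fin n) (Fin n) ℝ)
    (R : Θ → Matrix (Fin m) (Fin m) ℝ) (P : Θ → Matrix (Fin n) (Fin n) ℝ) : Prop :=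
  P ∈ SHInf μ n ∧ (∀ᵐ ℓ ∂μ, IsUnit (opR μ g G R P ℓ)) ∧
    ∀ᵐ ℓ ∂μ, P ℓ = riccatiRHS μ g A G Q R P ℓ

/-- `P` is a maximal solution over `𝐒₊`: a solution that dominates every element of `𝐒₊`. -/
def IsMaximalSolution (μ : Measure Θ) (g : Θ → Θ → ℝ) (A : Θ → Matrix (Fin n) (Fin n) ℝ)
    (G : Θ → Matrix (Fin n) (Fin m) ℝ) (Q : Θ → Matrix (Fin n) (Fin n) ℝ)
    (R : Θ → Matrix (Fin m) (Fin m) ℝ) (P : Θ → Matrix (Fin n) (Fin n) ℝ) : Prop :=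
  IsSolution μ g A G Q R P ∧
    ∀ P' ∈ SPlus μ g A G Q R, AENonneg μ fun ℓ => P ℓ - P' ℓ

/-- `P` is a stabilizing solution: a solution for which `u(k) = 𝓜(P)(ϑ(k)) x(k)` exponentially
stabilizes `(A, G | 𝔾)`. -/
def IsStabilizingSolution (μ : Measure Θ) (κ : Kernel Θ Θ) [IsMarkovKernel κ] (g : Θ → Θ → ℝ)
    (A : Θ → Matrix (Fin n) (Fin n) ℝ) (G : Θ → Matrix (Fin n) (Fin m) ℝ)
    (Q : Θ → Matrix (Fin n) (Fin n) ℝ) (R : Θ → Matrix (Fin m) (Fin m) ℝ)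
    (P : Θ → Matrix (Fin n) (Fin n) ℝ) : Prop :=
  IsSolution μ g A G Q R P ∧ ExpStabilizes μ κ A G (opM μ g A G R P)

/-- `(A, G | 𝔾)` is exponentially mean-square stabilizable and, for some `P ∈ 𝐒₊`,
`(A + G 𝓜(P); 𝓦(P)^{1/2} | 𝔾)` is detectable. -/
def StabDetectCondition (μ : Measure Θ) (κ : Kernel Θ Θ) [IsMarkovKernel κ] (g : Θ → Θ → ℝ)
    (A : Θ → Matrix (Fin n) (Fin n) ℝ) (G : Θ → Matrix (Fin n) (Fin m) ℝ)
    (Q : Θ → Matrix (Fin n) (Fin n) ℝ) (R : Θ → Matrix (Fin m) (Fin m) ℝ) : Prop :=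
  Stabilizable μ κ A G ∧
    ∃ P ∈ SPlus μ g A G Q R,
      Detectable μ κ (fun ℓ => A ℓ + G ℓ * opM μ g A G R P ℓ) (sqrtFun (opW μ g A G Q R P))

end

end MJLS

/-! Stability is first turned into matrix inequalities. Second moments of the state are given by the
powers of 𝓣_S, so mean-square stability amounts to a bounded V ≥ 0 with 𝓣_S(V) + εI ≤ V for some ε >
0 (`exists_lyapunov`, `EMSS_of_lyapunov`); after that the chain itself plays no part.

Completing the square exhibits the Riccati right-hand side F as the minimum, over gains K, of the
monotone affine maps P ↦ 𝓣_{A+GK}(P) + Q + KᵀRK; hence F is monotone where 𝓡 ≫ 0. Given B in 𝐒₊, so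
that B ≤ F(B), a stabilizing gain yields a supersolution P₀ ≥ B. Iterating F from P₀ decreases,
stays above B, and converges to a solution P ≥ B (`exists_solution_ge`).

The pivot is the identity Δ - 𝓣_S(Δ) = 𝓦(B) + Dᵀ𝓡(B)D for Δ = P - B, S = A + G𝓜(P), D = 𝓜(P) - 𝓜(B)
(`sub_eq_opT_sub`), used in two directions. Detectability provides a stable L with L - S =
H𝓦(B)^{1/2} - GD, so the decrease of Δ ≥ 0 along S pays for replacing L by S, and S is stable
(`EMSS_of_decrease`, `expStabilizes_of_detectable`). If instead S is known to be stable, the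
nonnegative right-hand side forces Δ ≥ 0 (`nonneg_of_opT_le`): stabilizing solutions are maximal,
and uniqueness is antisymmetry of the order. From (ii) to (i), the stabilizing solution itself
serves, with H = 0. -/

namespace MJLS

noncomputable section

/-! ### The Loewner order on real matrices -/

section Loewner

variable {n m p : ℕ}

theorem isSymm_of_le {A B : Matrix (Fin n) (Fin n) ℝ} (h : A ≤ B) (hA : A.IsSymm) : B.IsSymm := by
  have h1 : (B - A).IsSymm := by
    have := (Matrix.le_iff.1 h).isHermitian
    rwa [Matrix.IsHermitian, Matrix.conjTranspose_eq_transpose_of_trivial] at this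
  have := h1.add hA
  rwa [sub_add_cancel] at this

theorem isSymm_of_nonneg {A : Matrix (Fin n) (Fin n) ℝ} (h : 0 ≤ A) : A.IsSymm :=
  isSymm_of_le h Matrix.isSymm_zero

theorem nonneg_iff {A : Matrix (Fin n) (Fin n) ℝ} :
    0 ≤ A ↔ A.IsSymm ∧ ∀ x : Fin n → ℝ, 0 ≤ x ⬝ᵥ A *ᵥ x := by
  rw [Matrix.nonneg_iff_posSemidef, Matrix.posSemidef_iff_dotProduct_mulVec, Matrix.IsHermitian,
    Matrix.conjTranspose_eq_transpose_of_trivial, Matrix.IsSymm]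
  simp

theorem le_iff_of_isSymm {A B : Matrix (Fin n) (Fin n) ℝ} (hA : A.IsSymm) (hB : B.IsSymm) :
    A ≤ B ↔ ∀ x : Fin n → ℝ, x ⬝ᵥ A *ᵥ x ≤ x ⬝ᵥ B *ᵥ x := by
  rw [← sub_nonneg, nonneg_iff]
  simp only [Matrix.sub_mulVec, dotProduct_sub, sub_nonneg]
  exact ⟨fun h => h.2, fun h => ⟨hB.sub hA, h⟩⟩

theorem dotProduct_mulVec_mono {A B : Matrix (Fin n) (Fin n) ℝ} (h : A ≤ B) (x : Fin n → ℝ) :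
    x ⬝ᵥ A *ᵥ x ≤ x ⬝ᵥ B *ᵥ x := by
  have := (nonneg_iff.1 (sub_nonneg.2 h)).2 x
  simpa only [Matrix.sub_mulVec, dotProduct_sub, sub_nonneg] using this

theorem dotProduct_transpose_mul_mul (X : Matrix (Fin n) (Fin m) ℝ) (A : Matrix (Fin n) (Fin n) ℝ)
    (x : Fin m → ℝ) : x ⬝ᵥ (Xᵀ * A * X) *ᵥ x = (X *ᵥ x) ⬝ᵥ A *ᵥ (X *ᵥ x) := by
  rw [Matrix.mul_assoc, ← Matrix.mulVec_mulVec, Matrix.dotProduct_mulVec, Matrix.vecMul_transpose,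
    Matrix.mulVec_mulVec]

theorem transpose_mul_mul_mono {A B : Matrix (Fin n) (Fin n) ℝ} (h : A ≤ B)
    (X : Matrix (Fin n) (Fin m) ℝ) : Xᵀ * A * X ≤ Xᵀ * B * X := by
  have := (Matrix.le_iff.1 h).conjTranspose_mul_mul_same X
  rw [Matrix.le_iff, ← Matrix.conjTranspose_eq_transpose_of_trivial]
  simpa [Matrix.mul_sub, Matrix.sub_mul] using this

theorem transpose_mul_mul_nonneg {A : Matrix (Fin n) (Fin n) ℝ} (h : 0 ≤ A)
    (X : Matrix (Fin n) (Fin m) ℝ) : 0 ≤ Xᵀ * A * X := by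
  simpa using transpose_mul_mul_mono h X

theorem smul_mono_right {A B : Matrix (Fin n) (Fin n) ℝ} (h : A ≤ B) {c : ℝ} (hc : 0 ≤ c) :
    c • A ≤ c • B := by
  rw [Matrix.le_iff, ← smul_sub]
  exact (Matrix.le_iff.1 h).smul hc

theorem smul_mono_left {A : Matrix (Fin n) (Fin n) ℝ} (hA : 0 ≤ A) {c d : ℝ} (h : c ≤ d) :
    c • A ≤ d • A := by
  rw [← sub_nonneg, ← sub_smul]
  simpa using smul_mono_right hA (sub_nonneg.2 h)

theorem dotProduct_self_eq_norm_sq (x : Fin n → ℝ) : x ⬝ᵥ x = ‖WithLp.toLp 2 x‖ ^ 2 := by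
  rw [EuclideanSpace.real_norm_sq_eq]
  simp [dotProduct, sq]

theorem abs_dotProduct_mulVec_le (A : Matrix (Fin n) (Fin m) ℝ) (x : Fin n → ℝ) (y : Fin m → ℝ) :
    |x ⬝ᵥ A *ᵥ y| ≤ ‖A‖ * ‖WithLp.toLp 2 x‖ * ‖WithLp.toLp 2 y‖ := by
  have h := abs_real_inner_le_norm (WithLp.toLp 2 x) (WithLp.toLp 2 (A *ᵥ y))
  have h2 := Matrix.l2_opNorm_mulVec A (WithLp.toLp 2 y)
  rw [EuclideanSpace.inner_toLp_toLp] at h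
  simp only [star_trivial] at h
  rw [dotProduct_comm] at h
  calc _ ≤ _ := h
    _ ≤ ‖WithLp.toLp 2 x‖ * (‖A‖ * ‖WithLp.toLp 2 y‖) := by gcongr; exact h2
    _ = _ := by ring

theorem le_norm_smul_one {A : Matrix (Fin n) (Fin n) ℝ} (hA : A.IsSymm) : A ≤ ‖A‖ • 1 := by
  rw [le_iff_of_isSymm hA (Matrix.isSymm_one.smul _)]
  intro x
  have := (le_abs_self _).trans (abs_dotProduct_mulVec_le A x x)
  rw [Matrix.smul_mulVec, Matrix.one_mulVec, dotProduct_smul, dotProduct_self_eq_norm_sq]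
  simpa [sq, mul_assoc] using this

theorem le_smul_one_of_norm_le {A : Matrix (Fin n) (Fin n) ℝ} (hA : A.IsSymm) {c : ℝ}
    (h : ‖A‖ ≤ c) : A ≤ c • 1 :=
  (le_norm_smul_one hA).trans (smul_mono_left zero_le_one h)

theorem neg_smul_one_le_of_norm_le {A : Matrix (Fin n) (Fin n) ℝ} (hA : A.IsSymm) {c : ℝ}
    (h : ‖A‖ ≤ c) : -(c • 1) ≤ A :=
  neg_le.1 (le_smul_one_of_norm_le hA.neg (by rwa [norm_neg]))

theorem norm_le_of_forall_mulVec {A : Matrix (Fin n) (Fin m) ℝ} {c : ℝ} (hc : 0 ≤ c)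
    (h : ∀ x : Fin m → ℝ, (A *ᵥ x) ⬝ᵥ (A *ᵥ x) ≤ c ^ 2 * (x ⬝ᵥ x)) : ‖A‖ ≤ c := by
  rw [Matrix.l2_opNorm_def]
  refine ContinuousLinearMap.opNorm_le_bound _ hc fun x => ?_
  have := h x.ofLp
  rw [dotProduct_self_eq_norm_sq, dotProduct_self_eq_norm_sq, ← mul_pow] at this
  exact (sq_le_sq₀ (norm_nonneg _) (by positivity)).1 this

theorem sqrt_transpose_mul_self {A : Matrix (Fin n) (Fin n) ℝ} (hA : 0 ≤ A) :
    (CFC.sqrt A)ᵀ * CFC.sqrt A = A := by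
  rw [(isSymm_of_nonneg (CFC.sqrt_nonneg A)).eq, CFC.sqrt_mul_sqrt_self A hA]

theorem norm_sqrt_le {A : Matrix (Fin n) (Fin n) ℝ} {c : ℝ} (hc : 0 ≤ c) (hA : 0 ≤ A)
    (h : A ≤ c • 1) : ‖CFC.sqrt A‖ ≤ √c := by
  refine norm_le_of_forall_mulVec (Real.sqrt_nonneg _) fun x => ?_
  have h1 := dotProduct_transpose_mul_mul (CFC.sqrt A) 1 x
  have h2 := dotProduct_mulVec_mono h x
  rw [Matrix.mul_one, sqrt_transpose_mul_self hA, Matrix.one_mulVec] at h1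
  rw [← h1, Real.sq_sqrt hc]
  simpa [Matrix.smul_mulVec] using h2

/-- Factoring A through its square root reduces the claim to a bound on ‖√A x‖² = xᵀAx, with no
appeal to eigenvalues. -/
theorem norm_le_of_nonneg_of_le {A : Matrix (Fin n) (Fin n) ℝ} {c : ℝ} (hc : 0 ≤ c) (hA : 0 ≤ A)
    (h : A ≤ c • 1) : ‖A‖ ≤ c := by
  have h1 := norm_sqrt_le hc hA h
  calc ‖A‖ = ‖CFC.sqrt A * CFC.sqrt A‖ := by rw [CFC.sqrt_mul_sqrt_self A hA]
    _ ≤ ‖CFC.sqrt A‖ * ‖CFC.sqrt A‖ := Matrix.l2_opNorm_mul _ _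
    _ ≤ √c * √c := by gcongr
    _ = c := Real.mul_self_sqrt hc

theorem norm_le_of_le_of_le {A B C : Matrix (Fin n) (Fin n) ℝ} (hA : A.IsSymm) (hC : C.IsSymm)
    (h1 : A ≤ B) (h2 : B ≤ C) : ‖B‖ ≤ ‖C‖ + 2 * ‖A‖ := by
  have h3 : B - A ≤ (‖C‖ + ‖A‖) • 1 := by
    rw [add_smul, sub_eq_add_neg]
    refine add_le_add (h2.trans (le_norm_smul_one hC)) ?_
    have := le_norm_smul_one hA.neg
    rwa [norm_neg] at this
  have h4 := norm_le_of_nonneg_of_le (by positivity) (sub_nonneg.2 h1) h3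
  have h5 := norm_add_le (B - A) A
  rw [sub_add_cancel] at h5
  linarith

theorem isUnit_of_smul_one_le {A : Matrix (Fin n) (Fin n) ℝ} {ξ : ℝ} (hξ : 0 < ξ)
    (h : ξ • 1 ≤ A) : IsUnit A := by
  rw [← Matrix.mulVec_injective_iff_isUnit]
  intro x y hxy
  have h0 : A *ᵥ (x - y) = 0 := by rw [Matrix.mulVec_sub]; exact sub_eq_zero.2 hxy
  have h1 := dotProduct_mulVec_mono h (x - y)
  rw [h0, dotProduct_zero, Matrix.smul_mulVec, Matrix.one_mulVec, dotProduct_smul, smul_eq_mul] at h1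
  have h2 : 0 ≤ (x - y) ⬝ᵥ (x - y) := by rw [dotProduct_self_eq_norm_sq]; positivity
  have h3 : (x - y) ⬝ᵥ (x - y) = 0 := by nlinarith
  exact sub_eq_zero.1 (dotProduct_self_eq_zero.1 h3)

theorem norm_inv_le_of_smul_one_le {A : Matrix (Fin n) (Fin n) ℝ} {ξ : ℝ} (hξ : 0 < ξ)
    (h : ξ • 1 ≤ A) : ‖A⁻¹‖ ≤ ξ⁻¹ := by
  have hu := (Matrix.isUnit_iff_isUnit_det _).1 (isUnit_of_smul_one_le hξ h)
  refine norm_le_of_forall_mulVec (by positivity) fun x => ?_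
  set y := A⁻¹ *ᵥ x
  have hy : A *ᵥ y = x := by
    rw [Matrix.mulVec_mulVec, Matrix.mul_nonsing_inv _ hu, Matrix.one_mulVec]
  have h1 := dotProduct_mulVec_mono h y
  rw [hy, Matrix.smul_mulVec, Matrix.one_mulVec, dotProduct_smul, smul_eq_mul] at h1
  -- Expanding this square and inserting ξ|y|² ≤ y·x gives ξ²|y|² ≤ |x|².
  have h2 : 0 ≤ (x - ξ • y) ⬝ᵥ (x - ξ • y) := by
    rw [dotProduct_self_eq_norm_sq]; positivity
  simp only [sub_dotProduct, dotProduct_sub, dotProduct_smul, smul_dotProduct, smul_eq_mul,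
    dotProduct_comm x y] at h2
  have h3 : ξ ^ 2 * (y ⬝ᵥ y) ≤ x ⬝ᵥ x := by nlinarith
  rw [inv_pow, ← div_eq_inv_mul, le_div_iff₀ (by positivity)]
  linarith

end Loewner

/-! ### Measurability and boundedness -/

section HInf

variable {Θ : Type*} [MeasurableSpace Θ] {n m p : ℕ} {μ : Measure Θ}

theorem stronglyMeasurable_iff {Q : Θ → Matrix (Fin n) (Fin m) ℝ} :
    StronglyMeasurable Q ↔ ∀ i j, Measurable fun ℓ => Q ℓ i j := by
  constructor
  · intro h i j
    have : Continuous fun M : Matrix (Fin n) (Fin m) ℝ => M i j := by fun_prop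
    exact (this.comp_stronglyMeasurable h).measurable
  · intro h
    have : Measurable (β := Fin n → Fin m → ℝ) Q :=
      measurable_pi_lambda _ fun i => measurable_pi_lambda _ fun j => h i j
    exact this.stronglyMeasurable

theorem mem_HInf_iff {Q : Θ → Matrix (Fin n) (Fin m) ℝ} :
    Q ∈ HInf μ n m ↔ StronglyMeasurable Q ∧ ∃ c : ℝ, ∀ᵐ ℓ ∂μ, ‖Q ℓ‖ ≤ c := by
  rw [stronglyMeasurable_iff]; rfl

theorem exists_bound {Q : Θ → Matrix (Fin n) (Fin m) ℝ} (hQ : Q ∈ HInf μ n m) :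
    ∃ c : ℝ, 0 ≤ c ∧ ∀ᵐ ℓ ∂μ, ‖Q ℓ‖ ≤ c := by
  obtain ⟨c, hc⟩ := hQ.2
  exact ⟨max c 0, le_max_right _ _, hc.mono fun ℓ h => h.trans (le_max_left _ _)⟩

theorem HInf.add {P Q : Θ → Matrix (Fin n) (Fin m) ℝ} (hP : P ∈ HInf μ n m) (hQ : Q ∈ HInf μ n m) :
    (fun ℓ => P ℓ + Q ℓ) ∈ HInf μ n m := by
  rw [mem_HInf_iff] at *
  obtain ⟨c, hc⟩ := hP.2
  obtain ⟨d, hd⟩ := hQ.2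
  refine ⟨hP.1.add hQ.1, c + d, ?_⟩
  filter_upwards [hc, hd] with ℓ h1 h2 using (norm_add_le _ _).trans (add_le_add h1 h2)

theorem HInf.neg {P : Θ → Matrix (Fin n) (Fin m) ℝ} (hP : P ∈ HInf μ n m) :
    (fun ℓ => -P ℓ) ∈ HInf μ n m := by
  rw [mem_HInf_iff] at *
  obtain ⟨c, hc⟩ := hP.2
  exact ⟨hP.1.neg, c, hc.mono fun ℓ h => by rwa [norm_neg]⟩

theorem HInf.sub {P Q : Θ → Matrix (Fin n) (Fin m) ℝ} (hP : P ∈ HInf μ n m) (hQ : Q ∈ HInf μ n m) :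
    (fun ℓ => P ℓ - Q ℓ) ∈ HInf μ n m := by
  simpa only [sub_eq_add_neg] using HInf.add hP (HInf.neg hQ)

theorem HInf.smul {P : Θ → Matrix (Fin n) (Fin m) ℝ} (hP : P ∈ HInf μ n m) (c : ℝ) :
    (fun ℓ => c • P ℓ) ∈ HInf μ n m := by
  rw [mem_HInf_iff] at *
  obtain ⟨d, hd⟩ := hP.2
  refine ⟨hP.1.const_smul c, ‖c‖ * d, hd.mono fun ℓ h => ?_⟩
  rw [norm_smul]
  gcongr

theorem HInf.mul {P : Θ → Matrix (Fin n) (Fin m) ℝ} {Q : Θ → Matrix (Fin m) (Fin p) ℝ}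
    (hP : P ∈ HInf μ n m) (hQ : Q ∈ HInf μ m p) : (fun ℓ => P ℓ * Q ℓ) ∈ HInf μ n p := by
  obtain ⟨c, hc0, hc⟩ := exists_bound hP
  obtain ⟨d, hd0, hd⟩ := exists_bound hQ
  refine ⟨fun i j => ?_, c * d, ?_⟩
  · simp only [Matrix.mul_apply]
    exact Finset.measurable_sum _ fun k _ => (hP.1 i k).mul (hQ.1 k j)
  · filter_upwards [hc, hd] with ℓ h1 h2
    exact (Matrix.l2_opNorm_mul _ _).trans (by gcongr)

theorem HInf.transpose {P : Θ → Matrix (Fin n) (Fin m) ℝ} (hP : P ∈ HInf μ n m) :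
    (fun ℓ => (P ℓ)ᵀ) ∈ HInf μ m n := by
  obtain ⟨c, hc⟩ := hP.2
  refine ⟨fun i j => hP.1 j i, c, hc.mono fun ℓ h => ?_⟩
  rw [← Matrix.l2_opNorm_conjTranspose, Matrix.conjTranspose_eq_transpose_of_trivial] at h
  exact h

theorem HInf.const (M : Matrix (Fin n) (Fin m) ℝ) : (fun _ => M) ∈ HInf μ n m :=
  ⟨fun _ _ => measurable_const, ‖M‖, ae_of_all _ fun _ => le_rfl⟩

theorem SHInf.add {P Q : Θ → Matrix (Fin n) (Fin n) ℝ} (hP : P ∈ SHInf μ n) (hQ : Q ∈ SHInf μ n) :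
    (fun ℓ => P ℓ + Q ℓ) ∈ SHInf μ n :=
  ⟨HInf.add hP.1 hQ.1, by filter_upwards [hP.2, hQ.2] with ℓ h1 h2 using h1.add h2⟩

theorem SHInf.sub {P Q : Θ → Matrix (Fin n) (Fin n) ℝ} (hP : P ∈ SHInf μ n) (hQ : Q ∈ SHInf μ n) :
    (fun ℓ => P ℓ - Q ℓ) ∈ SHInf μ n :=
  ⟨HInf.sub hP.1 hQ.1, by filter_upwards [hP.2, hQ.2] with ℓ h1 h2 using h1.sub h2⟩

theorem SHInf.smul {P : Θ → Matrix (Fin n) (Fin n) ℝ} (hP : P ∈ SHInf μ n) (c : ℝ) :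
    (fun ℓ => c • P ℓ) ∈ SHInf μ n :=
  ⟨HInf.smul hP.1 c, hP.2.mono fun _ h => h.smul c⟩

theorem SHInf.one : (fun _ => 1) ∈ SHInf μ n :=
  ⟨HInf.const 1, ae_of_all _ fun _ => Matrix.isSymm_one⟩

theorem SHInf.zero : (fun _ => 0) ∈ SHInf μ n :=
  ⟨HInf.const 0, ae_of_all _ fun _ => Matrix.isSymm_zero⟩

/-- A measurable function lying between two symmetric essentially bounded ones is essentially
bounded. -/
theorem SHInf.of_le_of_le {P Q U : Θ → Matrix (Fin n) (Fin n) ℝ} (hP : P ∈ SHInf μ n)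
    (hQ : Q ∈ SHInf μ n) (hU : StronglyMeasurable U) (h1 : ∀ᵐ ℓ ∂μ, P ℓ ≤ U ℓ)
    (h2 : ∀ᵐ ℓ ∂μ, U ℓ ≤ Q ℓ) : U ∈ SHInf μ n := by
  obtain ⟨c, hc⟩ := hP.1.2
  obtain ⟨d, hd⟩ := hQ.1.2
  refine ⟨mem_HInf_iff.2 ⟨hU, d + 2 * c, ?_⟩, ?_⟩
  · filter_upwards [hc, hd, h1, h2, hP.2, hQ.2] with ℓ a b e f s t
    linarith [norm_le_of_le_of_le s t e f]
  · filter_upwards [h1, hP.2] with ℓ h s using isSymm_of_le h s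

/-- The adjugate formula covers singular matrices too: there the inverse of the determinant takes
the default value 0, and real inversion is still measurable. -/
theorem stronglyMeasurable_inv {Q : Θ → Matrix (Fin n) (Fin n) ℝ} (hQ : StronglyMeasurable Q) :
    StronglyMeasurable fun ℓ => (Q ℓ)⁻¹ := by
  simp only [Matrix.inv_def, Ring.inverse_eq_inv']
  have hdet : Continuous (Matrix.det : Matrix (Fin n) (Fin n) ℝ → ℝ) := by fun_prop
  have hadj : Continuous (Matrix.adjugate : Matrix (Fin n) (Fin n) ℝ → Matrix (Fin n) (Fin n) ℝ) :=
    continuous_id.matrix_adjugate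
  exact (hdet.comp_stronglyMeasurable hQ).measurable.inv.stronglyMeasurable.smul
    (hadj.comp_stronglyMeasurable hQ)

theorem continuousOn_sqrt :
    ContinuousOn (CFC.sqrt : Matrix (Fin n) (Fin n) ℝ → Matrix (Fin n) (Fin n) ℝ) {A | 0 ≤ A} := by
  exact ContinuousOn.cfcₙ_nnreal_of_mem_nhdsSet (s := Set.univ) NNReal.sqrt Filter.univ_mem
    continuousOn_id (fun _ h => h) NNReal.continuous_sqrt.continuousOn NNReal.sqrt_zero

theorem isClosed_nonneg : IsClosed {A : Matrix (Fin n) (Fin n) ℝ | 0 ≤ A} := by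
  have : {A : Matrix (Fin n) (Fin n) ℝ | 0 ≤ A} =
      {A | Aᵀ = A} ∩ ⋂ x : Fin n → ℝ, {A | 0 ≤ x ⬝ᵥ A *ᵥ x} := by
    ext A
    simp [nonneg_iff, Matrix.IsSymm]
  rw [this]
  refine (isClosed_eq (by fun_prop) (by fun_prop)).inter (isClosed_iInter fun x => ?_)
  exact isClosed_le (by fun_prop) (by fun_prop)

theorem stronglyMeasurable_sqrt {Q : Θ → Matrix (Fin n) (Fin n) ℝ} (hQ : StronglyMeasurable Q) :
    StronglyMeasurable fun ℓ => CFC.sqrt (Q ℓ) := by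
  classical
  let _ : MeasurableSpace (Matrix (Fin n) (Fin n) ℝ) := borel _
  have : BorelSpace (Matrix (Fin n) (Fin n) ℝ) := ⟨rfl⟩
  -- Off the closed cone of positive semidefinite matrices `CFC.sqrt` has the default value 0, so it
  -- is Borel as a piecewise continuous map.
  have h : (CFC.sqrt : Matrix (Fin n) (Fin n) ℝ → Matrix (Fin n) (Fin n) ℝ) =
      Set.piecewise {A | 0 ≤ A} CFC.sqrt (fun _ => 0) := by
    funext A
    by_cases hA : 0 ≤ A
    · simp [Set.piecewise, hA]
    · simp [Set.piecewise, hA, CFC.sqrt_of_not_nonneg hA]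
  have h2 : Measurable (CFC.sqrt : Matrix (Fin n) (Fin n) ℝ → Matrix (Fin n) (Fin n) ℝ) := by
    rw [h]
    exact continuousOn_sqrt.measurable_piecewise continuousOn_const isClosed_nonneg.measurableSet
  have h3 := h2.comp hQ.measurable
  have : SecondCountableTopology (Matrix (Fin n) (Fin n) ℝ) :=
    inferInstanceAs (SecondCountableTopology (Fin n → Fin n → ℝ))
  exact h3.stronglyMeasurable

end HInf

/-! ### The averaging operator and the Lyapunov operator -/

section Operators

variable {Θ : Type*} [MeasurableSpace Θ] {n m p : ℕ} {μ : Measure Θ} {κ : Kernel Θ Θ}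
  {g : Θ → Θ → ℝ}

/-- The transition probabilities of `κ` have the density `g` with respect to `μ`. -/
structure IsTransitionDensity (μ : Measure Θ) (κ : Kernel Θ Θ) (g : Θ → Θ → ℝ) : Prop where
  nonneg : ∀ ℓ t, 0 ≤ g ℓ t
  measurable : ∀ ℓ, Measurable (g ℓ)
  apply_eq : ∀ (ℓ : Θ) (Λ : Set Θ), MeasurableSet Λ →
    κ ℓ Λ = ∫⁻ t in Λ, ENNReal.ofReal (g ℓ t) ∂μ

theorem opE_isSymm {U : Θ → Matrix (Fin n) (Fin n) ℝ} (hU : U ∈ SHInf μ n) (ℓ : Θ) : (opE μ g U ℓ).IsSymm := by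
  ext i j
  simp only [Matrix.transpose_apply, opE, Matrix.of_apply]
  refine integral_congr_ae ?_
  filter_upwards [hU.2] with t ht
  rw [ht.apply]

theorem IsTransitionDensity.eq_withDensity (hg : IsTransitionDensity μ κ g) (ℓ : Θ) :
    κ ℓ = μ.withDensity fun t => ENNReal.ofReal (g ℓ t) := by
  ext Λ hΛ
  rw [hg.apply_eq ℓ Λ hΛ, withDensity_apply _ hΛ]

theorem IsTransitionDensity.absolutelyContinuous (hg : IsTransitionDensity μ κ g) (ℓ : Θ) :
    κ ℓ ≪ μ := by
  rw [hg.eq_withDensity]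
  exact withDensity_absolutelyContinuous _ _

theorem IsTransitionDensity.integral_eq (hg : IsTransitionDensity μ κ g) (ℓ : Θ) (f : Θ → ℝ) :
    ∫ t, g ℓ t * f t ∂μ = ∫ t, f t ∂κ ℓ := by
  rw [hg.eq_withDensity, integral_withDensity_eq_integral_toReal_smul
    (hg.measurable ℓ).ennreal_ofReal (ae_of_all _ fun _ => ENNReal.ofReal_lt_top)]
  simp [ENNReal.toReal_ofReal (hg.nonneg ℓ _)]

variable [IsMarkovKernel κ]

theorem IsTransitionDensity.integrable (hg : IsTransitionDensity μ κ g)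
    {U : Θ → Matrix (Fin n) (Fin m) ℝ} (hU : U ∈ HInf μ n m) (ℓ : Θ) : Integrable U (κ ℓ) := by
  obtain ⟨c, hc⟩ := hU.2
  exact Integrable.of_bound (mem_HInf_iff.1 hU).1.aestronglyMeasurable c
    ((hg.absolutelyContinuous ℓ).ae_le hc)

/-- Writing 𝓔 as a Bochner integral against κ makes its measurability in ℓ come from the kernel, so
no joint measurability of g is needed. -/
theorem IsTransitionDensity.opE_eq (hg : IsTransitionDensity μ κ g)
    {U : Θ → Matrix (Fin n) (Fin n) ℝ} (hU : U ∈ HInf μ n n) (ℓ : Θ) :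
    opE μ g U ℓ = ∫ t, U t ∂κ ℓ := by
  ext i j
  let L : Matrix (Fin n) (Fin n) ℝ →L[ℝ] ℝ :=
    LinearMap.toContinuousLinearMap (Matrix.entryLinearMap ℝ ℝ i j)
  have h : ∫ t, U t i j ∂κ ℓ = (∫ t, U t ∂κ ℓ) i j :=
    L.integral_comp_comm (hg.integrable hU ℓ)
  rw [← h, ← hg.integral_eq]
  rfl

theorem IsTransitionDensity.dotProduct_opE_mulVec (hg : IsTransitionDensity μ κ g)
    {U : Θ → Matrix (Fin n) (Fin n) ℝ} (hU : U ∈ HInf μ n n) (ℓ : Θ) (x : Fin n → ℝ) :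
    x ⬝ᵥ opE μ g U ℓ *ᵥ x = ∫ t, x ⬝ᵥ U t *ᵥ x ∂κ ℓ := by
  let L : Matrix (Fin n) (Fin n) ℝ →L[ℝ] ℝ := LinearMap.toContinuousLinearMap
    { toFun := fun M => x ⬝ᵥ M *ᵥ x
      map_add' := fun M N => by rw [Matrix.add_mulVec, dotProduct_add]
      map_smul' := fun c M => by rw [Matrix.smul_mulVec, dotProduct_smul]; rfl }
  rw [hg.opE_eq hU]
  exact (L.integral_comp_comm (hg.integrable hU ℓ)).symm

theorem IsTransitionDensity.integrable_dotProduct (hg : IsTransitionDensity μ κ g)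
    {U : Θ → Matrix (Fin n) (Fin n) ℝ} (hU : U ∈ HInf μ n n) (ℓ : Θ) (x : Fin n → ℝ) :
    Integrable (fun t => x ⬝ᵥ U t *ᵥ x) (κ ℓ) := by
  let L : Matrix (Fin n) (Fin n) ℝ →L[ℝ] ℝ := LinearMap.toContinuousLinearMap
    { toFun := fun M => x ⬝ᵥ M *ᵥ x
      map_add' := fun M N => by rw [Matrix.add_mulVec, dotProduct_add]
      map_smul' := fun c M => by rw [Matrix.smul_mulVec, dotProduct_smul]; rfl }
  exact L.integrable_comp (hg.integrable hU ℓ)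

theorem IsTransitionDensity.opE_mem (hg : IsTransitionDensity μ κ g)
    {U : Θ → Matrix (Fin n) (Fin n) ℝ} (hU : U ∈ HInf μ n n) : opE μ g U ∈ HInf μ n n := by
  have h : opE μ g U = fun ℓ => ∫ t, U t ∂κ ℓ := funext fun ℓ => hg.opE_eq hU ℓ
  obtain ⟨c, hc⟩ := hU.2
  rw [mem_HInf_iff, h]
  refine ⟨?_, c, ae_of_all _ fun ℓ => ?_⟩
  · exact StronglyMeasurable.integral_kernel (mem_HInf_iff.1 hU).1
  · have := norm_integral_le_of_norm_le_const ((hg.absolutelyContinuous ℓ).ae_le hc)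
    simpa using this

theorem IsTransitionDensity.norm_opE_le (hg : IsTransitionDensity μ κ g)
    {U : Θ → Matrix (Fin n) (Fin n) ℝ} (hU : U ∈ HInf μ n n) {c : ℝ} (hc : ∀ᵐ ℓ ∂μ, ‖U ℓ‖ ≤ c)
    (ℓ : Θ) : ‖opE μ g U ℓ‖ ≤ c := by
  have := norm_integral_le_of_norm_le_const ((hg.absolutelyContinuous ℓ).ae_le hc)
  rw [hg.opE_eq hU]
  simpa using this

theorem IsTransitionDensity.opE_sub (hg : IsTransitionDensity μ κ g)
    {U V : Θ → Matrix (Fin n) (Fin n) ℝ} (hU : U ∈ HInf μ n n) (hV : V ∈ HInf μ n n) (ℓ : Θ) :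
    opE μ g (fun t => U t - V t) ℓ = opE μ g U ℓ - opE μ g V ℓ := by
  rw [hg.opE_eq hU, hg.opE_eq hV, hg.opE_eq (HInf.sub hU hV),
    integral_sub (hg.integrable hU ℓ) (hg.integrable hV ℓ)]

theorem IsTransitionDensity.opE_add (hg : IsTransitionDensity μ κ g)
    {U V : Θ → Matrix (Fin n) (Fin n) ℝ} (hU : U ∈ HInf μ n n) (hV : V ∈ HInf μ n n) (ℓ : Θ) :
    opE μ g (fun t => U t + V t) ℓ = opE μ g U ℓ + opE μ g V ℓ := by
  rw [hg.opE_eq hU, hg.opE_eq hV, hg.opE_eq (HInf.add hU hV),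
    integral_add (hg.integrable hU ℓ) (hg.integrable hV ℓ)]

theorem opE_smul (U : Θ → Matrix (Fin n) (Fin n) ℝ) (c : ℝ) (ℓ : Θ) :
    opE μ g (fun t => c • U t) ℓ = c • opE μ g U ℓ := by
  ext i j
  simp only [opE, Matrix.of_apply, Matrix.smul_apply, smul_eq_mul, ← integral_const_mul]
  congr 1
  funext t
  ring

/-- Every κ(ℓ,·) is absolutely continuous with respect to μ, so a μ-a.e. hypothesis on U gives a
conclusion at every ℓ. -/
theorem IsTransitionDensity.opE_nonneg (hg : IsTransitionDensity μ κ g)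
    {U : Θ → Matrix (Fin n) (Fin n) ℝ} (hU : U ∈ SHInf μ n) (h : ∀ᵐ ℓ ∂μ, 0 ≤ U ℓ)
    (ℓ : Θ) : 0 ≤ opE μ g U ℓ := by
  rw [nonneg_iff]
  refine ⟨opE_isSymm hU ℓ, fun x => ?_⟩
  rw [hg.dotProduct_opE_mulVec hU.1]
  refine integral_nonneg_of_ae ((hg.absolutelyContinuous ℓ).ae_le ?_)
  filter_upwards [h] with t ht using (nonneg_iff.1 ht).2 x

theorem IsTransitionDensity.opE_mono (hg : IsTransitionDensity μ κ g)
    {U V : Θ → Matrix (Fin n) (Fin n) ℝ} (hU : U ∈ SHInf μ n) (hV : V ∈ SHInf μ n)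
    (h : ∀ᵐ ℓ ∂μ, U ℓ ≤ V ℓ) (ℓ : Θ) : opE μ g U ℓ ≤ opE μ g V ℓ := by
  rw [← sub_nonneg, ← hg.opE_sub hV.1 hU.1]
  exact hg.opE_nonneg (SHInf.sub hV hU) (h.mono fun _ h => sub_nonneg.2 h) ℓ

theorem IsTransitionDensity.opT_mono (hg : IsTransitionDensity μ κ g)
    {U V : Θ → Matrix (Fin n) (Fin n) ℝ} (hU : U ∈ SHInf μ n) (hV : V ∈ SHInf μ n)
    (h : ∀ᵐ ℓ ∂μ, U ℓ ≤ V ℓ) (S : Θ → Matrix (Fin n) (Fin m) ℝ) (ℓ : Θ) :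
    opT μ g S U ℓ ≤ opT μ g S V ℓ :=
  transpose_mul_mul_mono (hg.opE_mono hU hV h ℓ) _

theorem IsTransitionDensity.opT_nonneg (hg : IsTransitionDensity μ κ g)
    {U : Θ → Matrix (Fin n) (Fin n) ℝ} (hU : U ∈ SHInf μ n) (h : ∀ᵐ ℓ ∂μ, 0 ≤ U ℓ)
    (S : Θ → Matrix (Fin n) (Fin m) ℝ) (ℓ : Θ) : 0 ≤ opT μ g S U ℓ :=
  transpose_mul_mul_nonneg (hg.opE_nonneg hU h ℓ) _

theorem IsTransitionDensity.opT_add (hg : IsTransitionDensity μ κ g)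
    {U V : Θ → Matrix (Fin n) (Fin n) ℝ} (hU : U ∈ HInf μ n n) (hV : V ∈ HInf μ n n)
    (S : Θ → Matrix (Fin n) (Fin m) ℝ) (ℓ : Θ) :
    opT μ g S (fun t => U t + V t) ℓ = opT μ g S U ℓ + opT μ g S V ℓ := by
  simp only [opT, hg.opE_add hU hV, Matrix.mul_add, Matrix.add_mul]

theorem IsTransitionDensity.opT_sub (hg : IsTransitionDensity μ κ g)
    {U V : Θ → Matrix (Fin n) (Fin n) ℝ} (hU : U ∈ HInf μ n n) (hV : V ∈ HInf μ n n)
    (S : Θ → Matrix (Fin n) (Fin m) ℝ) (ℓ : Θ) :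
    opT μ g S (fun t => U t - V t) ℓ = opT μ g S U ℓ - opT μ g S V ℓ := by
  simp only [opT, hg.opE_sub hU hV, Matrix.mul_sub, Matrix.sub_mul]

theorem opT_smul (U : Θ → Matrix (Fin n) (Fin n) ℝ) (c : ℝ) (S : Θ → Matrix (Fin n) (Fin m) ℝ)
    (ℓ : Θ) : opT μ g S (fun t => c • U t) ℓ = c • opT μ g S U ℓ := by
  simp only [opT, opE_smul, Matrix.mul_smul, Matrix.smul_mul]

theorem transpose_mul_mul_isSymm {A : Matrix (Fin n) (Fin n) ℝ} (hA : A.IsSymm)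
    (X : Matrix (Fin n) (Fin m) ℝ) : (Xᵀ * A * X).IsSymm := by
  simp [Matrix.IsSymm, Matrix.transpose_mul, hA.eq, Matrix.mul_assoc]

theorem IsTransitionDensity.opT_mem (hg : IsTransitionDensity μ κ g)
    {S : Θ → Matrix (Fin n) (Fin m) ℝ} (hS : S ∈ HInf μ n m)
    {U : Θ → Matrix (Fin n) (Fin n) ℝ} (hU : U ∈ SHInf μ n) : opT μ g S U ∈ SHInf μ m :=
  ⟨HInf.mul (HInf.mul (HInf.transpose hS) (hg.opE_mem hU.1)) hS,
    ae_of_all _ fun ℓ => transpose_mul_mul_isSymm (opE_isSymm hU ℓ) _⟩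

end Operators

/-! ### The Markov chain and the Lyapunov criterion for stability -/

section Chain

variable {Θ : Type*} [MeasurableSpace Θ] {n m p : ℕ} {μ : Measure Θ} {κ : Kernel Θ Θ}
  [IsMarkovKernel κ] {g : Θ → Θ → ℝ} {μ₀ : Measure Θ} [IsProbabilityMeasure μ₀]

instance (k : ℕ) : IsMarkovKernel (stepKernel κ k) := by
  unfold stepKernel; infer_instance

instance : IsProbabilityMeasure (chainLaw κ μ₀) := by
  unfold chainLaw; infer_instance

/-- The state is a function of strictly earlier modes; this is what lets the Markov property be
applied to it. -/
theorem state_congr {Θ : Type*} {n : ℕ} (S : Θ → Matrix (Fin n) (Fin n) ℝ) (x₀ : EuclideanSpace ℝ (Fin n))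
    {ϑ ϑ' : ℕ → Θ} {k : ℕ} (h : ∀ i < k, ϑ i = ϑ' i) : state S x₀ ϑ k = state S x₀ ϑ' k := by
  induction k with
  | zero => rfl
  | succ k ih =>
    simp only [state]
    rw [ih fun i hi => h i (hi.trans (Nat.lt_succ_self k)), h k (Nat.lt_succ_self k)]

theorem measurable_state {S : Θ → Matrix (Fin n) (Fin n) ℝ} (hS : ∀ i j, Measurable fun ℓ => S ℓ i j)
    (x₀ : EuclideanSpace ℝ (Fin n)) (k : ℕ) : Measurable fun ϑ : ℕ → Θ => state S x₀ ϑ k := by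
  induction k with
  | zero => exact measurable_const
  | succ k ih =>
    simp only [state]
    refine (WithLp.measurable_toLp 2 (Fin n → ℝ)).comp (measurable_pi_lambda _ fun i => ?_)
    simp only [Matrix.mulVec, dotProduct]
    refine Finset.measurable_sum _ fun j _ => ?_
    exact ((hS i j).comp (measurable_pi_apply k)).mul
      ((measurable_pi_apply j).comp ((WithLp.measurable_ofLp 2 (Fin n → ℝ)).comp ih))

/-- The Markov property: the next mode is distributed according to `κ` given the past. -/
theorem lintegral_chainLaw_succ (k : ℕ)
    {f : ((_ : Finset.Iic k) → Θ) × Θ → ℝ≥0∞} (hf : Measurable f) :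
    ∫⁻ ϑ, f (Preorder.frestrictLe (π := fun _ => Θ) k ϑ, ϑ (k + 1)) ∂chainLaw κ μ₀ =
      ∫⁻ ϑ, ∫⁻ t, f (Preorder.frestrictLe (π := fun _ => Θ) k ϑ, t) ∂κ (ϑ k) ∂chainLaw κ μ₀ := by
  have h := Kernel.map_frestrictLe_trajMeasure_compProd_eq_map_trajMeasure (X := fun _ => Θ)
    (μ₀ := μ₀) (κ := stepKernel κ) (a := k)
  have h1 : Measurable fun ϑ : ℕ → Θ => (Preorder.frestrictLe (π := fun _ => Θ) k ϑ, ϑ (k + 1)) := by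
    fun_prop
  have h2 := lintegral_map hf h1 (μ := chainLaw κ μ₀)
  rw [← h2]
  unfold chainLaw
  rw [← h, Measure.lintegral_compProd hf, lintegral_map]
  · rfl
  · exact hf.lintegral_kernel_prod_right'
  · fun_prop

theorem map_eval_zero_chainLaw : (chainLaw κ μ₀).map (fun ϑ => ϑ 0) = μ₀ := by
  have h1 : (fun ϑ : ℕ → Θ => ϑ 0) =
      MeasurableEquiv.piUnique (fun _ : Finset.Iic 0 => Θ) ∘
        Preorder.frestrictLe (π := fun _ => Θ) 0 := rfl
  rw [h1, ← Measure.map_map (by fun_prop) (by fun_prop)]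
  unfold chainLaw Kernel.trajMeasure
  rw [Measure.map_comp _ _ (by fun_prop), Kernel.traj_map_frestrictLe, Kernel.partialTraj_self,
    Measure.id_comp, Measure.map_map (by fun_prop) (by fun_prop)]
  exact (congrArg (fun f => Measure.map f μ₀)
    (MeasurableEquiv.self_comp_symm (MeasurableEquiv.piUnique _))).trans Measure.map_id

/-- Allows properties that hold only μ-a.e. to be used along almost every path: a μ-null set is
charged neither by μ₀ nor by any transition. -/
theorem map_eval_chainLaw_absolutelyContinuous (hκ : ∀ ℓ, κ ℓ ≪ μ) (h₀ : μ₀ ≪ μ) (k : ℕ) :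
    (chainLaw κ μ₀).map (fun ϑ => ϑ k) ≪ μ := by
  cases k with
  | zero => rwa [map_eval_zero_chainLaw]
  | succ k =>
    refine Measure.AbsolutelyContinuous.mk fun s hs h => ?_
    have h1 := lintegral_chainLaw_succ (κ := κ) (μ₀ := μ₀) k
      (f := fun q => s.indicator 1 q.2) ((measurable_one.indicator hs).comp measurable_snd)
    rw [Measure.map_apply (measurable_pi_apply _) hs,
      ← lintegral_indicator_one ((measurable_pi_apply (k + 1)) hs)]
    refine Eq.trans h1 ?_
    simp only [lintegral_indicator_one hs, hκ _ h, lintegral_zero]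

end Chain

/-! ### Second moments of the state and Lyapunov functions. -/

section Lyapunov

variable {Θ : Type*} [MeasurableSpace Θ] {n m p : ℕ} {μ : Measure Θ} {κ : Kernel Θ Θ}
  [IsMarkovKernel κ] {g : Θ → Θ → ℝ} {μ₀ : Measure Θ} [IsProbabilityMeasure μ₀]

theorem measurable_dotProduct_mulVec {U : Θ → Matrix (Fin n) (Fin n) ℝ}
    (hU : ∀ i j, Measurable fun ℓ => U ℓ i j) :
    Measurable fun q : EuclideanSpace ℝ (Fin n) × Θ => q.1.ofLp ⬝ᵥ U q.2 *ᵥ q.1.ofLp := by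
  have h (i : Fin n) : Measurable fun q : EuclideanSpace ℝ (Fin n) × Θ => q.1.ofLp i :=
    (measurable_pi_apply i).comp ((WithLp.measurable_ofLp 2 (Fin n → ℝ)).comp measurable_fst)
  simp only [Matrix.mulVec, dotProduct]
  exact Finset.measurable_sum _ fun i _ => (h i).mul
    (Finset.measurable_sum _ fun j _ => ((hU i j).comp measurable_snd).mul (h j))

/-- One step of the chain: averaging a function of the next mode and of the next state. -/
theorem lintegral_state_succ {S : Θ → Matrix (Fin n) (Fin n) ℝ}
    (hS : ∀ i j, Measurable fun ℓ => S ℓ i j) (x₀ : EuclideanSpace ℝ (Fin n)) (k : ℕ)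
    {f : EuclideanSpace ℝ (Fin n) × Θ → ℝ≥0∞} (hf : Measurable f) :
    ∫⁻ ϑ, f (state S x₀ ϑ (k + 1), ϑ (k + 1)) ∂chainLaw κ μ₀ =
      ∫⁻ ϑ, ∫⁻ t, f (state S x₀ ϑ (k + 1), t) ∂κ (ϑ k) ∂chainLaw κ μ₀ := by
  -- A history up to time k is extended to a path by freezing its last mode. The state at time k + 1
  -- reads only modes up to k, so it is unaffected.
  let ext : ((_ : Finset.Iic k) → Θ) → ℕ → Θ := fun h i =>
    h ⟨min i k, Finset.mem_Iic.2 (min_le_right i k)⟩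
  have hext : Measurable ext := measurable_pi_lambda _ fun i => measurable_pi_apply _
  have hstate (ϑ : ℕ → Θ) :
      state S x₀ (ext (Preorder.frestrictLe (π := fun _ => Θ) k ϑ)) (k + 1) =
        state S x₀ ϑ (k + 1) := by
    refine state_congr S x₀ fun i hi => ?_
    change ϑ (min i k) = ϑ i
    rw [min_eq_left (Nat.lt_succ_iff.1 hi)]
  have h := lintegral_chainLaw_succ (κ := κ) (μ₀ := μ₀) k
    (f := fun q => f (state S x₀ (ext q.1) (k + 1), q.2))
    (hf.comp (((measurable_state hS x₀ (k + 1)).comp (hext.comp measurable_fst)).prodMk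
      measurable_snd))
  simpa only [hstate] using h

/-- Averaging over the next mode replaces U by 𝓔(U), and substituting x(k+1) = Sx(k) conjugates it
by S. Positivity of U permits passing between the real integral and the Lebesgue one. -/
theorem IsTransitionDensity.lintegral_quadratic_succ (hg : IsTransitionDensity μ κ g)
    {S : Θ → Matrix (Fin n) (Fin n) ℝ} (hS : ∀ i j, Measurable fun ℓ => S ℓ i j)
    {U : Θ → Matrix (Fin n) (Fin n) ℝ} (hU : U ∈ SHInf μ n) (hU0 : ∀ᵐ ℓ ∂μ, 0 ≤ U ℓ)
    (x₀ : EuclideanSpace ℝ (Fin n)) (k : ℕ) :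
    ∫⁻ ϑ, ENNReal.ofReal ((state S x₀ ϑ (k + 1)).ofLp ⬝ᵥ U (ϑ (k + 1)) *ᵥ
        (state S x₀ ϑ (k + 1)).ofLp) ∂chainLaw κ μ₀ =
      ∫⁻ ϑ, ENNReal.ofReal ((state S x₀ ϑ k).ofLp ⬝ᵥ opT μ g S U (ϑ k) *ᵥ
        (state S x₀ ϑ k).ofLp) ∂chainLaw κ μ₀ := by
  rw [lintegral_state_succ hS x₀ k
    (f := fun q => ENNReal.ofReal (q.1.ofLp ⬝ᵥ U q.2 *ᵥ q.1.ofLp))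
    (measurable_dotProduct_mulVec hU.1.1).ennreal_ofReal]
  refine lintegral_congr fun ϑ => ?_
  dsimp only
  rw [← ofReal_integral_eq_lintegral_ofReal (hg.integrable_dotProduct hU.1 _ _),
    ← hg.dotProduct_opE_mulVec hU.1, opT, dotProduct_transpose_mul_mul]
  · rfl
  · refine (hg.absolutelyContinuous _).ae_le ?_
    filter_upwards [hU0] with t ht using (nonneg_iff.1 ht).2 _

/-- The powers `𝓣_S^k(I)`, which measure the second moments of the state. -/
def momentFun (μ : Measure Θ) (g : Θ → Θ → ℝ) (S : Θ → Matrix (Fin n) (Fin n) ℝ) :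
    ℕ → Θ → Matrix (Fin n) (Fin n) ℝ
  | 0 => fun _ => 1
  | k + 1 => opT μ g S (momentFun μ g S k)

theorem IsTransitionDensity.momentFun_mem (hg : IsTransitionDensity μ κ g)
    {S : Θ → Matrix (Fin n) (Fin n) ℝ} (hS : S ∈ HInf μ n n) (k : ℕ) :
    momentFun μ g S k ∈ SHInf μ n := by
  induction k with
  | zero => exact SHInf.one
  | succ k ih => exact hg.opT_mem hS ih

theorem IsTransitionDensity.momentFun_nonneg (hg : IsTransitionDensity μ κ g)
    {S : Θ → Matrix (Fin n) (Fin n) ℝ} (hS : S ∈ HInf μ n n) (k : ℕ) :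
    ∀ᵐ ℓ ∂μ, 0 ≤ momentFun μ g S k ℓ := by
  induction k with
  | zero => exact ae_of_all _ fun _ => zero_le_one
  | succ k ih => exact ae_of_all _ fun ℓ => hg.opT_nonneg (hg.momentFun_mem hS k) ih S ℓ

theorem IsTransitionDensity.lintegral_norm_sq_state (hg : IsTransitionDensity μ κ g)
    {S : Θ → Matrix (Fin n) (Fin n) ℝ} (hS : S ∈ HInf μ n n)
    (x₀ : EuclideanSpace ℝ (Fin n)) (k : ℕ) :
    ∫⁻ ϑ, ENNReal.ofReal (‖state S x₀ ϑ k‖ ^ 2) ∂chainLaw κ μ₀ =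
      ∫⁻ ℓ, ENNReal.ofReal (x₀.ofLp ⬝ᵥ momentFun μ g S k ℓ *ᵥ x₀.ofLp) ∂μ₀ := by
  -- Each step back in time raises the power of 𝓣_S by one, so the value depends on i + j only. The
  -- second moment is the case j = 0.
  have key : ∀ i j, ∫⁻ ϑ, ENNReal.ofReal ((state S x₀ ϑ i).ofLp ⬝ᵥ
        momentFun μ g S j (ϑ i) *ᵥ (state S x₀ ϑ i).ofLp) ∂chainLaw κ μ₀ =
      ∫⁻ ϑ, ENNReal.ofReal (x₀.ofLp ⬝ᵥ momentFun μ g S (i + j) (ϑ 0) *ᵥ x₀.ofLp)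
        ∂chainLaw κ μ₀ := by
    intro i
    induction i with
    | zero => intro j; simp only [zero_add]; rfl
    | succ i ih =>
      intro j
      rw [hg.lintegral_quadratic_succ hS.1 (hg.momentFun_mem hS j) (hg.momentFun_nonneg hS j)]
      have := ih (j + 1)
      rw [show i + (j + 1) = i + 1 + j by ring] at this
      exact this
  have h := key k 0
  have h2 : ∫⁻ ℓ, ENNReal.ofReal (x₀.ofLp ⬝ᵥ momentFun μ g S k ℓ *ᵥ x₀.ofLp)
      ∂((chainLaw κ μ₀).map fun ϑ => ϑ 0) =
      ∫⁻ ϑ, ENNReal.ofReal (x₀.ofLp ⬝ᵥ momentFun μ g S k (ϑ 0) *ᵥ x₀.ofLp) ∂chainLaw κ μ₀ := by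
    refine lintegral_map ?_ (measurable_pi_apply 0)
    exact ((measurable_dotProduct_mulVec (hg.momentFun_mem hS k).1.1).comp
      (measurable_const.prodMk measurable_id)).ennreal_ofReal
  rw [map_eval_zero_chainLaw] at h2
  rw [h2]
  simp only [momentFun, Matrix.one_mulVec, dotProduct_self_eq_norm_sq, add_zero] at h
  exact h

/-- A bound on the averages under all absolutely continuous initial laws is an a.e. bound. -/
theorem ae_le_of_forall_lintegral_le [SigmaFinite μ] {f : Θ → ℝ} (hf : Measurable f) {c : ℝ}
    (h : ∀ (μ₀ : Measure Θ) [IsProbabilityMeasure μ₀], μ₀ ≪ μ →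
      ∫⁻ ℓ, ENNReal.ofReal (f ℓ) ∂μ₀ ≤ ENNReal.ofReal c) (hc : 0 ≤ c) : ∀ᵐ ℓ ∂μ, f ℓ ≤ c := by
  have h1 : (fun ℓ => ENNReal.ofReal (f ℓ)) ≤ᵐ[μ] fun _ => ENNReal.ofReal c := by
    refine ae_le_of_forall_setLIntegral_le_of_sigmaFinite hf.ennreal_ofReal fun s hs hs' => ?_
    by_cases h0 : μ s = 0
    · simp [Measure.restrict_eq_zero.2 h0]
    -- The test law is μ conditioned on s, for s of finite nonzero measure.
    · have : IsProbabilityMeasure (μ[|s]) := cond_isProbabilityMeasure_of_finite h0 hs'.ne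
      have h2 := h (μ[|s]) cond_absolutelyContinuous
      rw [ProbabilityTheory.cond, lintegral_smul_measure, smul_eq_mul,
        ENNReal.inv_mul_le_iff h0 hs'.ne] at h2
      simpa [mul_comm] using h2
  filter_upwards [h1] with ℓ hℓ using (ENNReal.ofReal_le_ofReal_iff hc).1 hℓ

theorem IsTransitionDensity.momentFun_le_of_EMSS [SigmaFinite μ] (hg : IsTransitionDensity μ κ g)
    {S : Θ → Matrix (Fin n) (Fin n) ℝ} (hS : S ∈ HInf μ n n) {β α : ℝ} (hβ : 0 ≤ β) (hα : 0 ≤ α)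
    (h : ∀ (x₀ : EuclideanSpace ℝ (Fin n)) (μ₀ : Measure Θ) [IsProbabilityMeasure μ₀], μ₀ ≪ μ →
      ∀ k : ℕ, ∫⁻ ϑ, ENNReal.ofReal (‖state S x₀ ϑ k‖ ^ 2) ∂(chainLaw κ μ₀) ≤
        ENNReal.ofReal (β * α ^ k * ‖x₀‖ ^ 2)) (k : ℕ) :
    ∀ᵐ ℓ ∂μ, momentFun μ g S k ℓ ≤ (β * α ^ k) • 1 := by
  have hm := hg.momentFun_mem hS k
  have h1 (x : Fin n → ℝ) :
      ∀ᵐ ℓ ∂μ, x ⬝ᵥ momentFun μ g S k ℓ *ᵥ x ≤ β * α ^ k * (x ⬝ᵥ x) := by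
    refine ae_le_of_forall_lintegral_le ?_ (fun μ₀ _ hμ₀ => ?_) ?_
    · exact (measurable_dotProduct_mulVec hm.1.1).comp
        (measurable_const (a := WithLp.toLp 2 x) |>.prodMk measurable_id)
    · have := h (WithLp.toLp 2 x) μ₀ hμ₀ k
      rwa [hg.lintegral_norm_sq_state hS, ← dotProduct_self_eq_norm_sq] at this
    · rw [dotProduct_self_eq_norm_sq]; positivity
  -- The exceptional null set in `h1` depends on x, so the bound is taken on a countable dense set
  -- and extended by continuity.
  have h2 := ae_all_iff.2 fun i => h1 (TopologicalSpace.denseSeq (Fin n → ℝ) i)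
  filter_upwards [h2, hm.2] with ℓ hℓ hs
  rw [le_iff_of_isSymm hs (Matrix.isSymm_one.smul _)]
  intro x
  rw [Matrix.smul_mulVec, Matrix.one_mulVec, dotProduct_smul, smul_eq_mul]
  refine (TopologicalSpace.denseRange_denseSeq (Fin n → ℝ)).induction_on
    (p := fun x => x ⬝ᵥ momentFun μ g S k ℓ *ᵥ x ≤ β * α ^ k * (x ⬝ᵥ x)) x ?_ hℓ
  exact isClosed_le (by fun_prop) (by fun_prop)

/-- The partial sums of the second moment functions. -/
theorem IsTransitionDensity.sum_momentFun (hg : IsTransitionDensity μ κ g)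
    {S : Θ → Matrix (Fin n) (Fin n) ℝ} (hS : S ∈ HInf μ n n) (N : ℕ) :
    ∃ V ∈ SHInf μ n, (∀ᵐ ℓ ∂μ, 0 ≤ V ℓ) ∧
      ∀ ℓ, opT μ g S V ℓ + 1 = V ℓ + momentFun μ g S N ℓ := by
  induction N with
  | zero => exact ⟨fun _ => 0, SHInf.zero, ae_of_all _ fun _ => le_rfl, fun ℓ => by
      have := opT_smul (μ := μ) (g := g) (fun _ => 0) 0 S ℓ
      simp only [zero_smul] at this
      rw [this]; rfl⟩
  | succ N ih =>
    obtain ⟨V, hV, hV0, hVe⟩ := ih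
    -- V is the sum of 𝓣_S^k(I) over k < N; applying 𝓣_S shifts the summands, which gives the
    -- telescoping identity.
    refine ⟨fun ℓ => V ℓ + momentFun μ g S N ℓ, SHInf.add hV (hg.momentFun_mem hS N), ?_,
      fun ℓ => ?_⟩
    · filter_upwards [hV0, hg.momentFun_nonneg hS N] with ℓ h1 h2 using add_nonneg h1 h2
    · rw [hg.opT_add hV.1 (hg.momentFun_mem hS N).1, add_right_comm, hVe]
      rfl

/-- An exponentially mean-square stable system has a Lyapunov function. -/
theorem IsTransitionDensity.exists_lyapunov [SigmaFinite μ] (hg : IsTransitionDensity μ κ g)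
    {S : Θ → Matrix (Fin n) (Fin n) ℝ} (hS : S ∈ HInf μ n n) (h : EMSS μ κ S) :
    ∃ V ∈ SHInf μ n, (∀ᵐ ℓ ∂μ, 1 ≤ V ℓ) ∧ ∀ᵐ ℓ ∂μ, opT μ g S V ℓ + 1 ≤ V ℓ := by
  obtain ⟨β, α, hβ, hα0, hα1, h⟩ := h
  -- A finite sum suffices: once 𝓣_S^N(I) ≤ I/2, doubling 𝓣_S(V) + I = V + 𝓣_S^N(I) leaves a margin
  -- of I, so 2V is the Lyapunov function.
  obtain ⟨N, hN⟩ : ∃ N : ℕ, β * α ^ N ≤ 1 / 2 := by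
    have : Tendsto (fun N : ℕ => β * α ^ N) atTop (nhds (β * 0)) :=
      (tendsto_pow_atTop_nhds_zero_of_lt_one hα0.le hα1).const_mul β
    rw [mul_zero] at this
    exact ((this.eventually (gt_mem_nhds (by norm_num : (0 : ℝ) < 1 / 2))).exists).imp
      fun _ h => h.le
  obtain ⟨V, hV, hV0, hVe⟩ := hg.sum_momentFun hS N
  have h1 : ∀ᵐ ℓ ∂μ, opT μ g S (fun t => (2 : ℝ) • V t) ℓ + 1 ≤ (2 : ℝ) • V ℓ := by
    filter_upwards [hg.momentFun_le_of_EMSS hS (by linarith) hα0.le h N] with ℓ hℓ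
    have h2 := smul_mono_right (hℓ.trans (smul_mono_left zero_le_one hN)) (zero_le_two (α := ℝ))
    rw [smul_smul, show (2 : ℝ) * (1 / 2) = 1 by norm_num, one_smul] at h2
    have h3 := congrArg (fun M => (2 : ℝ) • M) (hVe ℓ)
    simp only [smul_add] at h3
    rw [opT_smul, ← sub_nonneg]
    rw [← sub_nonneg] at h2
    convert h2 using 1
    have h4 : (2 : ℝ) • (1 : Matrix (Fin n) (Fin n) ℝ) = 1 + 1 := two_smul _ _
    rw [h4] at h3
    linear_combination (norm := module) h3.symm
  refine ⟨fun ℓ => (2 : ℝ) • V ℓ, SHInf.smul hV 2, ?_, h1⟩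
  filter_upwards [h1] with ℓ hℓ
  refine le_trans (le_add_of_nonneg_left ?_) hℓ
  refine hg.opT_nonneg (SHInf.smul hV 2) ?_ S ℓ
  filter_upwards [hV0] with t ht
  simpa using smul_mono_right ht (zero_le_two (α := ℝ))

/-- A Lyapunov function forces exponential mean-square stability. -/
theorem IsTransitionDensity.EMSS_of_lyapunov (hg : IsTransitionDensity μ κ g)
    {S : Θ → Matrix (Fin n) (Fin n) ℝ} (hS : S ∈ HInf μ n n)
    {V : Θ → Matrix (Fin n) (Fin n) ℝ} (hV : V ∈ SHInf μ n) (hV0 : ∀ᵐ ℓ ∂μ, 0 ≤ V ℓ)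
    {ε : ℝ} (hε : 0 < ε) (h : ∀ᵐ ℓ ∂μ, opT μ g S V ℓ + ε • 1 ≤ V ℓ) : EMSS μ κ S := by
  obtain ⟨c₀, hc₀, hVc₀⟩ := exists_bound hV.1
  -- The added 2ε ensures ε < c, so that the rate 1 - ε/c is in (0,1) and the constant c/ε is at
  -- least 1, even when V or n vanishes.
  set c := c₀ + 2 * ε
  have hc : 0 < c := by positivity
  have hεc : ε < c := by simp only [c]; linarith
  have hVc : ∀ᵐ ℓ ∂μ, V ℓ ≤ c • 1 := by
    filter_upwards [hVc₀, hV.2] with ℓ h1 h2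
    exact le_smul_one_of_norm_le h2 (by simp only [c]; linarith)
  have hρ0 : 0 < 1 - ε / c := by rw [sub_pos, div_lt_one hc]; exact hεc
  have hεV : ∀ᵐ ℓ ∂μ, ε • 1 ≤ V ℓ := by
    filter_upwards [h] with ℓ hℓ
    exact (le_add_of_nonneg_left (hg.opT_nonneg hV hV0 S ℓ)).trans hℓ
  have hdec : ∀ᵐ ℓ ∂μ, opT μ g S V ℓ ≤ (1 - ε / c) • V ℓ := by
    filter_upwards [h, hVc] with ℓ h1 h2
    have h3 := smul_mono_right h2 (c := ε / c) (by positivity)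
    rw [smul_smul, div_mul_cancel₀ _ hc.ne'] at h3
    rw [sub_smul, one_smul]
    calc _ ≤ V ℓ - ε • 1 := le_sub_iff_add_le.2 h1
      _ ≤ _ := sub_le_sub_left h3 _
  refine ⟨c / ε, 1 - ε / c, ?_, hρ0, by linarith [div_pos hε hc], fun x₀ μ₀ _ hμ₀ k => ?_⟩
  · rw [le_div_iff₀ hε]; linarith
  have hae (i : ℕ) {q : Θ → Prop} (hq : ∀ᵐ ℓ ∂μ, q ℓ) : ∀ᵐ ϑ ∂chainLaw κ μ₀, q (ϑ i) :=
    ae_of_ae_map (measurable_pi_apply i).aemeasurable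
      ((map_eval_chainLaw_absolutelyContinuous hg.absolutelyContinuous hμ₀ i).ae_le hq)
  have hdecay (i : ℕ) : ∫⁻ ϑ, ENNReal.ofReal ((state S x₀ ϑ i).ofLp ⬝ᵥ V (ϑ i) *ᵥ
        (state S x₀ ϑ i).ofLp) ∂chainLaw κ μ₀ ≤
      ENNReal.ofReal ((1 - ε / c) ^ i * (c * ‖x₀‖ ^ 2)) := by
    induction i with
    | zero =>
      have : ∫⁻ ϑ, ENNReal.ofReal ((state S x₀ ϑ 0).ofLp ⬝ᵥ V (ϑ 0) *ᵥ
          (state S x₀ ϑ 0).ofLp) ∂chainLaw κ μ₀ ≤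
          ∫⁻ _, ENNReal.ofReal (c * ‖x₀‖ ^ 2) ∂chainLaw κ μ₀ := by
        refine lintegral_mono_ae ?_
        filter_upwards [hae 0 hVc] with ϑ hϑ
        refine ENNReal.ofReal_le_ofReal ?_
        have h2 := dotProduct_mulVec_mono hϑ x₀.ofLp
        rw [Matrix.smul_mulVec, Matrix.one_mulVec, dotProduct_smul,
          dotProduct_self_eq_norm_sq] at h2
        exact h2
      simpa using this
    | succ i ih =>
      rw [hg.lintegral_quadratic_succ hS.1 hV hV0]
      calc _ ≤ ∫⁻ ϑ, ENNReal.ofReal (1 - ε / c) * ENNReal.ofReal ((state S x₀ ϑ i).ofLp ⬝ᵥ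
            V (ϑ i) *ᵥ (state S x₀ ϑ i).ofLp) ∂chainLaw κ μ₀ := by
            refine lintegral_mono_ae ?_
            filter_upwards [hae i hdec] with ϑ hϑ
            rw [← ENNReal.ofReal_mul hρ0.le]
            refine ENNReal.ofReal_le_ofReal ?_
            have h2 := dotProduct_mulVec_mono hϑ (state S x₀ ϑ i).ofLp
            rwa [Matrix.smul_mulVec, dotProduct_smul, smul_eq_mul] at h2
        _ = ENNReal.ofReal (1 - ε / c) * ∫⁻ ϑ, ENNReal.ofReal ((state S x₀ ϑ i).ofLp ⬝ᵥ
            V (ϑ i) *ᵥ (state S x₀ ϑ i).ofLp) ∂chainLaw κ μ₀ :=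
            lintegral_const_mul' _ _ ENNReal.ofReal_ne_top
        _ ≤ ENNReal.ofReal (1 - ε / c) * ENNReal.ofReal ((1 - ε / c) ^ i * (c * ‖x₀‖ ^ 2)) := by
            gcongr
        _ = _ := by rw [← ENNReal.ofReal_mul hρ0.le]; congr 1; ring
  calc ∫⁻ ϑ, ENNReal.ofReal (‖state S x₀ ϑ k‖ ^ 2) ∂chainLaw κ μ₀
      ≤ ∫⁻ ϑ, ENNReal.ofReal ε⁻¹ * ENNReal.ofReal ((state S x₀ ϑ k).ofLp ⬝ᵥ
            V (ϑ k) *ᵥ (state S x₀ ϑ k).ofLp) ∂chainLaw κ μ₀ := by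
        refine lintegral_mono_ae ?_
        filter_upwards [hae k hεV] with ϑ hϑ
        rw [← ENNReal.ofReal_mul (by positivity)]
        refine ENNReal.ofReal_le_ofReal ?_
        have h2 := dotProduct_mulVec_mono hϑ (state S x₀ ϑ k).ofLp
        rw [Matrix.smul_mulVec, Matrix.one_mulVec, dotProduct_smul, dotProduct_self_eq_norm_sq,
          smul_eq_mul] at h2
        rw [← div_eq_inv_mul, le_div_iff₀ hε, mul_comm]
        exact h2
    _ = ENNReal.ofReal ε⁻¹ * ∫⁻ ϑ, ENNReal.ofReal ((state S x₀ ϑ k).ofLp ⬝ᵥ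
            V (ϑ k) *ᵥ (state S x₀ ϑ k).ofLp) ∂chainLaw κ μ₀ :=
        lintegral_const_mul' _ _ ENNReal.ofReal_ne_top
    _ ≤ ENNReal.ofReal ε⁻¹ * ENNReal.ofReal ((1 - ε / c) ^ k * (c * ‖x₀‖ ^ 2)) := by
        gcongr
        exact hdecay k
    _ = _ := by rw [← ENNReal.ofReal_mul (by positivity)]; congr 1; field_simp

end Lyapunov

/-! ### Transfer of stability between closed loops, and positivity along a stable one. -/

section Comparison

variable {Θ : Type*} [MeasurableSpace Θ] {n m p : ℕ} {μ : Measure Θ} {κ : Kernel Θ Θ}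
  [IsMarkovKernel κ] {g : Θ → Θ → ℝ}

/-- The right side minus the left is ε⁻¹(εX + Y)ᵀE(εX + Y). -/
theorem transpose_sub_mul_mul_le {E : Matrix (Fin n) (Fin n) ℝ} (hE : 0 ≤ E)
    (X Y : Matrix (Fin n) (Fin m) ℝ) {ε : ℝ} (hε : 0 < ε) :
    (X - Y)ᵀ * E * (X - Y) ≤ (1 + ε) • (Xᵀ * E * X) + (1 + ε⁻¹) • (Yᵀ * E * Y) := by
  rw [← sub_nonneg]
  have h := smul_mono_right (transpose_mul_mul_nonneg hE (ε • X + Y)) (inv_nonneg.2 hε.le)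
  rw [smul_zero] at h
  convert h using 1
  simp only [Matrix.transpose_add, Matrix.transpose_smul, Matrix.transpose_sub, Matrix.add_mul,
    Matrix.mul_add, Matrix.sub_mul, Matrix.mul_sub, Matrix.smul_mul, Matrix.mul_smul]
  match_scalars <;> field_simp <;> ring

/-- If `L` is stable and the quadratic form of `L - S` is controlled by the decrease along `S` of a
positive semidefinite function, then `S` is stable. -/
theorem IsTransitionDensity.EMSS_of_decrease [SigmaFinite μ] (hg : IsTransitionDensity μ κ g)
    {S L : Θ → Matrix (Fin n) (Fin n) ℝ} (hS : S ∈ HInf μ n n) (hL : L ∈ HInf μ n n)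
    (h : EMSS μ κ L) {Δ : Θ → Matrix (Fin n) (Fin n) ℝ} (hΔ : Δ ∈ SHInf μ n)
    (hΔ0 : ∀ᵐ ℓ ∂μ, 0 ≤ Δ ℓ) {c : ℝ} (hc : 0 ≤ c)
    (hdec : ∀ᵐ ℓ ∂μ, (L ℓ - S ℓ)ᵀ * (L ℓ - S ℓ) ≤ c • (Δ ℓ - opT μ g S Δ ℓ)) : EMSS μ κ S := by
  obtain ⟨Y, hY, hY1, hYL⟩ := hg.exists_lyapunov hL h
  obtain ⟨b₀, hb₀, hYb₀⟩ := exists_bound hY.1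
  set b := b₀ + 1
  have hb : 0 < b := by positivity
  have hYb : ∀ᵐ ℓ ∂μ, ‖Y ℓ‖ ≤ b := hYb₀.mono fun ℓ h => by simp only [b]; linarith
  have hY0 : ∀ᵐ ℓ ∂μ, 0 ≤ Y ℓ := hY1.mono fun ℓ h => zero_le_one.trans h
  -- Splitting S = L - (L - S) with weight ε costs εY ≤ I/2, half of the margin I that Y has along
  -- L. The other term is at most K(L - S)ᵀ(L - S), which the decrease of KcΔ absorbs.
  set ε := (2 * b)⁻¹
  have hε : 0 < ε := by positivity
  set K := (1 + ε⁻¹) * b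
  have hK : 0 ≤ K := by positivity
  have hKΔ : (fun ℓ => (K * c) • Δ ℓ) ∈ SHInf μ n := SHInf.smul hΔ _
  refine hg.EMSS_of_lyapunov hS (V := fun ℓ => Y ℓ + (K * c) • Δ ℓ) (SHInf.add hY hKΔ) ?_
    (ε := 1 / 2) (by norm_num) ?_
  · filter_upwards [hY0, hΔ0] with ℓ h1 h2
    have := smul_mono_right h2 (mul_nonneg hK hc)
    rw [smul_zero] at this
    exact add_nonneg h1 this
  filter_upwards [hYL, hYb, hY.2, hdec] with ℓ h1 h2 h3 h4
  rw [hg.opT_add hY.1 hKΔ.1, opT_smul]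
  have hE0 := hg.opE_nonneg hY hY0 ℓ
  have hEb : opE μ g Y ℓ ≤ b • 1 :=
    le_smul_one_of_norm_le (opE_isSymm hY ℓ) (hg.norm_opE_le hY.1 hYb ℓ)
  have h5 : opT μ g S Y ℓ ≤ (1 + ε) • opT μ g L Y ℓ +
      (1 + ε⁻¹) • ((L ℓ - S ℓ)ᵀ * opE μ g Y ℓ * (L ℓ - S ℓ)) := by
    have := transpose_sub_mul_mul_le hE0 (L ℓ) (L ℓ - S ℓ) hε
    rwa [sub_sub_cancel] at this
  have h6 : (1 + ε) • opT μ g L Y ℓ ≤ (1 + ε) • (Y ℓ - 1) :=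
    smul_mono_right (le_sub_iff_add_le.2 h1) (by positivity)
  have h7 : (1 + ε⁻¹) • ((L ℓ - S ℓ)ᵀ * opE μ g Y ℓ * (L ℓ - S ℓ)) ≤
      (K * c) • (Δ ℓ - opT μ g S Δ ℓ) := by
    have e1 := smul_mono_right (transpose_mul_mul_mono hEb (L ℓ - S ℓ))
      (show 0 ≤ 1 + ε⁻¹ by positivity)
    rw [Matrix.mul_smul, Matrix.smul_mul, Matrix.mul_one, smul_smul] at e1
    refine e1.trans ?_
    have e2 := smul_mono_right h4 hK
    rwa [smul_smul] at e2
  have h8 : ε • Y ℓ ≤ (1 / 2 : ℝ) • 1 := by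
    have := smul_mono_right (le_smul_one_of_norm_le h3 h2) hε.le
    rwa [smul_smul, show ε * b = 1 / 2 by simp only [ε]; field_simp] at this
  have h9 : 0 ≤ ε • (1 : Matrix (Fin n) (Fin n) ℝ) := by
    simpa using smul_mono_right (zero_le_one (α := Matrix (Fin n) (Fin n) ℝ)) hε.le
  have h10 := add_le_add (add_le_add (h5.trans (add_le_add h6 h7)) h8) h9
  rw [← sub_nonneg] at h10 ⊢
  convert h10 using 1
  module

/-- Along a stable system, a function dominating its own average is positive semidefinite. -/
theorem IsTransitionDensity.nonneg_of_opT_le [SigmaFinite μ] (hg : IsTransitionDensity μ κ g)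
    {S : Θ → Matrix (Fin n) (Fin n) ℝ} (hS : S ∈ HInf μ n n) (h : EMSS μ κ S)
    {Δ : Θ → Matrix (Fin n) (Fin n) ℝ} (hΔ : Δ ∈ SHInf μ n)
    (hle : ∀ᵐ ℓ ∂μ, opT μ g S Δ ℓ ≤ Δ ℓ) : ∀ᵐ ℓ ∂μ, 0 ≤ Δ ℓ := by
  obtain ⟨V, hV, hV1, hVS⟩ := hg.exists_lyapunov hS h
  obtain ⟨b₀, hb₀, hVb₀⟩ := exists_bound hV.1
  obtain ⟨c, hc, hΔc⟩ := exists_bound hΔ.1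
  set b := b₀ + 1
  have hb : 0 < b := by positivity
  set ρ := 1 - b⁻¹
  have hρ0 : 0 ≤ ρ := by
    have : b⁻¹ ≤ 1 := inv_le_one_of_one_le₀ (by simp only [b]; linarith)
    simp only [ρ]; linarith
  have hρ1 : ρ < 1 := by
    have : 0 < b⁻¹ := by positivity
    simp only [ρ]; linarith
  have hdec : ∀ᵐ ℓ ∂μ, opT μ g S V ℓ ≤ ρ • V ℓ := by
    filter_upwards [hVS, hVb₀, hV.2] with ℓ h1 h2 h3
    have h4 := smul_mono_right (le_smul_one_of_norm_le h3 (c := b) (by simp only [b]; linarith))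
      (show 0 ≤ b⁻¹ by positivity)
    rw [smul_smul, inv_mul_cancel₀ hb.ne', one_smul] at h4
    simp only [ρ, sub_smul, one_smul]
    exact (le_sub_iff_add_le.2 h1).trans (sub_le_sub_left h4 _)
  have hmem (k : ℕ) : (fun ℓ => (-(ρ ^ k * c)) • V ℓ) ∈ SHInf μ n := SHInf.smul hV _
  -- Since V ≥ I, the bound holds at k = 0. Applying the monotone 𝓣_S multiplies the left side by at
  -- most ρ in size and keeps the right side below Δ; k → ∞ then gives Δ ≥ 0.
  have hk : ∀ k : ℕ, ∀ᵐ ℓ ∂μ, (-(ρ ^ k * c)) • V ℓ ≤ Δ ℓ := by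
    intro k
    induction k with
    | zero =>
      filter_upwards [hΔc, hΔ.2, hV1] with ℓ h1 h2 h3
      rw [pow_zero, one_mul, neg_smul]
      exact (neg_le_neg (smul_mono_right h3 hc)).trans (neg_smul_one_le_of_norm_le h2 h1)
    | succ k ih =>
      filter_upwards [hle, hdec] with ℓ h1 h2
      refine le_trans ?_ ((hg.opT_mono (hmem k) hΔ ih S ℓ).trans h1)
      rw [opT_smul, neg_smul, neg_smul]
      refine neg_le_neg ((smul_mono_right h2 (by positivity)).trans (le_of_eq ?_))
      rw [smul_smul]
      congr 1
      ring
  filter_upwards [ae_all_iff.2 hk, hΔ.2] with ℓ h1 h2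
  refine nonneg_iff.2 ⟨h2, fun x => ?_⟩
  have h3 : Tendsto (fun k : ℕ => -(ρ ^ k * c) * (x ⬝ᵥ V ℓ *ᵥ x)) atTop
      (nhds (-(0 * c) * (x ⬝ᵥ V ℓ *ᵥ x))) :=
    (((tendsto_pow_atTop_nhds_zero_of_lt_one hρ0 hρ1).mul_const c).neg).mul_const _
  rw [zero_mul, neg_zero, zero_mul] at h3
  refine le_of_tendsto h3 (Eventually.of_forall fun k => ?_)
  have := dotProduct_mulVec_mono (h1 k) x
  rwa [Matrix.smul_mulVec, dotProduct_smul, smul_eq_mul] at this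

end Comparison

/-! ### The Riccati operator -/

section Riccati

variable {Θ : Type*} [MeasurableSpace Θ] {n m p : ℕ} {μ : Measure Θ} {κ : Kernel Θ Θ}
  [IsMarkovKernel κ] {g : Θ → Θ → ℝ}

/-- Completion of the square. -/
theorem riccati_complete_square (A : Matrix (Fin n) (Fin n) ℝ) (G : Matrix (Fin n) (Fin m) ℝ)
    (K : Matrix (Fin m) (Fin n) ℝ) (Q E : Matrix (Fin n) (Fin n) ℝ) (R : Matrix (Fin m) (Fin m) ℝ)
    (hE : E.IsSymm) (hR : R.IsSymm) (hu : IsUnit (R + Gᵀ * E * G)) :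
    (A + G * K)ᵀ * E * (A + G * K) + Q + Kᵀ * R * K =
      Aᵀ * E * A + Q - (Gᵀ * E * A)ᵀ * (R + Gᵀ * E * G)⁻¹ * (Gᵀ * E * A) +
        (K - -((R + Gᵀ * E * G)⁻¹ * (Gᵀ * E * A)))ᵀ * (R + Gᵀ * E * G) *
          (K - -((R + Gᵀ * E * G)⁻¹ * (Gᵀ * E * A))) := by
  have hN : (Gᵀ * E * A)ᵀ = Aᵀ * E * G := by
    simp [Matrix.transpose_mul, hE.eq, Matrix.mul_assoc]
  generalize hB : R + Gᵀ * E * G = B at *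
  have hBs : B.IsSymm := hB ▸ hR.add (transpose_mul_mul_isSymm hE G)
  have hBi : (B⁻¹)ᵀ = B⁻¹ := by rw [Matrix.transpose_nonsing_inv, hBs.eq]
  have hBu := (Matrix.isUnit_iff_isUnit_det _).1 hu
  have hK : Kᵀ * B * K = Kᵀ * R * K + Kᵀ * (Gᵀ * E * G) * K := by
    rw [← hB, Matrix.mul_add, Matrix.add_mul]
  have h1 : (K - -(B⁻¹ * (Gᵀ * E * A)))ᵀ * B * (K - -(B⁻¹ * (Gᵀ * E * A))) =
      Kᵀ * B * K + Kᵀ * (Gᵀ * E * A) + Aᵀ * E * G * K +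
        (Gᵀ * E * A)ᵀ * B⁻¹ * (Gᵀ * E * A) := by
    have e1 : B * (B⁻¹ * (Gᵀ * E * A)) = Gᵀ * E * A := by
      rw [← Matrix.mul_assoc, Matrix.mul_nonsing_inv _ hBu, Matrix.one_mul]
    have e2 : B⁻¹ * (B * K) = K := by
      rw [← Matrix.mul_assoc, Matrix.nonsing_inv_mul _ hBu, Matrix.one_mul]
    rw [sub_neg_eq_add, Matrix.transpose_add, Matrix.transpose_mul, hBi, hN, Matrix.mul_assoc,
      Matrix.mul_add B, e1, Matrix.add_mul, Matrix.mul_add, Matrix.mul_add,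
      Matrix.mul_assoc (Aᵀ * E * G), e2, Matrix.mul_assoc Kᵀ B K]
    abel
  rw [h1, hK]
  simp only [Matrix.transpose_add, Matrix.transpose_mul, Matrix.add_mul, Matrix.mul_add,
    Matrix.mul_assoc]
  abel

variable {A Q : Θ → Matrix (Fin n) (Fin n) ℝ} {G : Θ → Matrix (Fin n) (Fin m) ℝ}
  {R : Θ → Matrix (Fin m) (Fin m) ℝ} {P P' : Θ → Matrix (Fin n) (Fin n) ℝ}

theorem opT_add_gain (hP : P ∈ SHInf μ n) (K : Θ → Matrix (Fin m) (Fin n) ℝ) {ℓ : Θ}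
    (hR : (R ℓ).IsSymm) (hu : IsUnit (opR μ g G R P ℓ)) :
    opT μ g (fun ℓ => A ℓ + G ℓ * K ℓ) P ℓ + Q ℓ + (K ℓ)ᵀ * R ℓ * K ℓ =
      riccatiRHS μ g A G Q R P ℓ + (K ℓ - opM μ g A G R P ℓ)ᵀ * opR μ g G R P ℓ *
        (K ℓ - opM μ g A G R P ℓ) :=
  riccati_complete_square (A ℓ) (G ℓ) (K ℓ) (Q ℓ) (opE μ g P ℓ) (R ℓ) (opE_isSymm hP ℓ) hR hu

theorem opT_opM (hP : P ∈ SHInf μ n) {ℓ : Θ} (hR : (R ℓ).IsSymm)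
    (hu : IsUnit (opR μ g G R P ℓ)) :
    opT μ g (fun ℓ => A ℓ + G ℓ * opM μ g A G R P ℓ) P ℓ + Q ℓ +
      (opM μ g A G R P ℓ)ᵀ * R ℓ * opM μ g A G R P ℓ = riccatiRHS μ g A G Q R P ℓ := by
  rw [opT_add_gain hP (opM μ g A G R P) hR hu]
  simp

theorem SignCondition.exists_le (h : SignCondition μ g G R P) :
    ∃ ξ : ℝ, 0 < ξ ∧ ∀ᵐ ℓ ∂μ, ξ • 1 ≤ opR μ g G R P ℓ := h

theorem SignCondition.isUnit (h : SignCondition μ g G R P) :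
    ∀ᵐ ℓ ∂μ, IsUnit (opR μ g G R P ℓ) := by
  obtain ⟨ξ, hξ, h⟩ := h.exists_le
  exact h.mono fun ℓ => isUnit_of_smul_one_le hξ

theorem SignCondition.nonneg (h : SignCondition μ g G R P) :
    ∀ᵐ ℓ ∂μ, 0 ≤ opR μ g G R P ℓ := by
  obtain ⟨ξ, hξ, h⟩ := h.exists_le
  refine h.mono fun ℓ hℓ => le_trans ?_ hℓ
  simpa using smul_mono_right (zero_le_one (α := Matrix (Fin m) (Fin m) ℝ)) hξ.le

theorem IsTransitionDensity.signCondition_mono (hg : IsTransitionDensity μ κ g)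
    (hP : P ∈ SHInf μ n) (hP' : P' ∈ SHInf μ n) (hle : ∀ᵐ ℓ ∂μ, P ℓ ≤ P' ℓ)
    (h : SignCondition μ g G R P) : SignCondition μ g G R P' := by
  obtain ⟨ξ, hξ, h⟩ := h.exists_le
  refine ⟨ξ, hξ, h.mono fun ℓ hℓ => ?_⟩
  exact hℓ.trans (add_le_add_right (hg.opT_mono hP hP' hle G ℓ) _)

theorem IsTransitionDensity.opR_mem (hg : IsTransitionDensity μ κ g) (hG : G ∈ HInf μ n m)
    (hR : R ∈ SHInf μ m) (hP : P ∈ SHInf μ n) : opR μ g G R P ∈ SHInf μ m :=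
  SHInf.add hR (hg.opT_mem hG hP)

theorem IsTransitionDensity.opG_mem (hg : IsTransitionDensity μ κ g) (hA : A ∈ HInf μ n n)
    (hG : G ∈ HInf μ n m) (hP : P ∈ SHInf μ n) : opG μ g A G P ∈ HInf μ m n :=
  HInf.mul (HInf.mul (HInf.transpose hG) (hg.opE_mem hP.1)) hA

theorem IsTransitionDensity.opR_inv_mem (hg : IsTransitionDensity μ κ g) (hG : G ∈ HInf μ n m)
    (hR : R ∈ SHInf μ m) (hP : P ∈ SHInf μ n) (h : SignCondition μ g G R P) :
    (fun ℓ => (opR μ g G R P ℓ)⁻¹) ∈ HInf μ m m := by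
  obtain ⟨ξ, hξ, h⟩ := h.exists_le
  refine mem_HInf_iff.2 ⟨?_, ξ⁻¹, h.mono fun ℓ hℓ => norm_inv_le_of_smul_one_le hξ hℓ⟩
  exact stronglyMeasurable_inv (mem_HInf_iff.1 (hg.opR_mem hG hR hP).1).1

theorem IsTransitionDensity.opM_mem (hg : IsTransitionDensity μ κ g) (hA : A ∈ HInf μ n n)
    (hG : G ∈ HInf μ n m) (hR : R ∈ SHInf μ m) (hP : P ∈ SHInf μ n)
    (h : SignCondition μ g G R P) : opM μ g A G R P ∈ HInf μ m n :=
  HInf.neg (HInf.mul (hg.opR_inv_mem hG hR hP h) (hg.opG_mem hA hG hP))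

theorem IsTransitionDensity.riccatiRHS_mem (hg : IsTransitionDensity μ κ g) (hA : A ∈ HInf μ n n)
    (hG : G ∈ HInf μ n m) (hQ : Q ∈ SHInf μ n) (hR : R ∈ SHInf μ m) (hP : P ∈ SHInf μ n)
    (h : SignCondition μ g G R P) : riccatiRHS μ g A G Q R P ∈ SHInf μ n := by
  have hGm := hg.opG_mem hA hG hP
  refine SHInf.sub (SHInf.add (hg.opT_mem hA hP) hQ)
    ⟨HInf.mul (HInf.mul (HInf.transpose hGm) (hg.opR_inv_mem hG hR hP h)) hGm, ?_⟩
  filter_upwards [(hg.opR_mem hG hR hP).2] with ℓ hℓ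
  refine transpose_mul_mul_isSymm ?_ _
  rw [Matrix.IsSymm, Matrix.transpose_nonsing_inv, hℓ.eq]

theorem IsTransitionDensity.opW_mem (hg : IsTransitionDensity μ κ g) (hA : A ∈ HInf μ n n)
    (hG : G ∈ HInf μ n m) (hQ : Q ∈ SHInf μ n) (hR : R ∈ SHInf μ m) (hP : P ∈ SHInf μ n)
    (h : SignCondition μ g G R P) : opW μ g A G Q R P ∈ SHInf μ n := by
  have e : opW μ g A G Q R P = fun ℓ => riccatiRHS μ g A G Q R P ℓ - P ℓ :=
    funext fun ℓ => neg_add_eq_sub _ _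
  rw [e]
  exact SHInf.sub (hg.riccatiRHS_mem hA hG hQ hR hP h) hP

/-- Every gain gives an upper bound for the Riccati operator. -/
theorem riccatiRHS_le_gain (hR : R ∈ SHInf μ m) (hP : P ∈ SHInf μ n)
    (h : SignCondition μ g G R P) (K : Θ → Matrix (Fin m) (Fin n) ℝ) :
    ∀ᵐ ℓ ∂μ, riccatiRHS μ g A G Q R P ℓ ≤
      opT μ g (fun ℓ => A ℓ + G ℓ * K ℓ) P ℓ + Q ℓ + (K ℓ)ᵀ * R ℓ * K ℓ := by
  filter_upwards [h.isUnit, h.nonneg, hR.2] with ℓ h1 h2 h3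
  rw [opT_add_gain hP K h3 h1]
  exact le_add_of_nonneg_right (transpose_mul_mul_nonneg h2 _)

/-- The gain optimal for P' is admissible, though suboptimal, for P, and for a fixed gain the cost
is monotone in P. -/
theorem IsTransitionDensity.riccatiRHS_mono (hg : IsTransitionDensity μ κ g) (hR : R ∈ SHInf μ m)
    (hP : P ∈ SHInf μ n) (hP' : P' ∈ SHInf μ n) (hle : ∀ᵐ ℓ ∂μ, P ℓ ≤ P' ℓ)
    (h : SignCondition μ g G R P) :
    ∀ᵐ ℓ ∂μ, riccatiRHS μ g A G Q R P ℓ ≤ riccatiRHS μ g A G Q R P' ℓ := by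
  have h' := hg.signCondition_mono hP hP' hle h
  filter_upwards [riccatiRHS_le_gain (A := A) (Q := Q) hR hP h (opM μ g A G R P'), h'.isUnit, hR.2]
    with ℓ h1 h2 h3
  rw [← opT_opM hP' h3 h2]
  exact h1.trans (add_le_add_left (add_le_add_left (hg.opT_mono hP hP' hle _ ℓ) _) _)

/-- The difference of a solution and of any function with invertible `𝓡`. -/
theorem IsTransitionDensity.sub_eq_opT_sub (hg : IsTransitionDensity μ κ g) (hR : R ∈ SHInf μ m)
    (hP : IsSolution μ g A G Q R P) (hP' : P' ∈ SHInf μ n)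
    (hu : ∀ᵐ ℓ ∂μ, IsUnit (opR μ g G R P' ℓ)) :
    ∀ᵐ ℓ ∂μ, P ℓ - P' ℓ =
      opT μ g (fun ℓ => A ℓ + G ℓ * opM μ g A G R P ℓ) (fun ℓ => P ℓ - P' ℓ) ℓ +
        (opW μ g A G Q R P' ℓ + (opM μ g A G R P ℓ - opM μ g A G R P' ℓ)ᵀ * opR μ g G R P' ℓ *
          (opM μ g A G R P ℓ - opM μ g A G R P' ℓ)) := by
  filter_upwards [hP.2.1, hP.2.2, hR.2, hu] with ℓ h1 h2 h3 h4
  -- Both squares are completed at the same gain 𝓜(P), so the Q and R terms cancel on subtraction.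
  have e1 := opT_opM (A := A) (Q := Q) hP.1 h3 h1
  have e2 := opT_add_gain (A := A) (Q := Q) hP' (opM μ g A G R P) h3 h4
  rw [← h2] at e1
  rw [hg.opT_sub hP.1.1 hP'.1, opW]
  linear_combination (norm := module) e2 - e1

end Riccati

/-! ### Value iteration -/

section Limit

variable {Θ : Type*} [MeasurableSpace Θ] {n m p : ℕ} {μ : Measure Θ} {κ : Kernel Θ Θ}
  [IsMarkovKernel κ] {g : Θ → Θ → ℝ}

theorem apply_eq_polarization {A : Matrix (Fin n) (Fin n) ℝ} (hA : A.IsSymm) (i j : Fin n) :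
    A i j = ((Pi.single i 1 + Pi.single j 1) ⬝ᵥ A *ᵥ (Pi.single i 1 + Pi.single j 1) -
      Pi.single i 1 ⬝ᵥ A *ᵥ Pi.single i 1 - Pi.single j 1 ⬝ᵥ A *ᵥ Pi.single j 1) / 2 := by
  simp only [Matrix.mulVec_add, dotProduct_add, add_dotProduct, Matrix.mulVec_single_one,
    single_one_dotProduct, Matrix.col_apply]
  rw [hA.apply i j]
  ring

/-- A decreasing sequence of symmetric matrices that is bounded below converges. -/
theorem exists_tendsto_of_antitone {B : Matrix (Fin n) (Fin n) ℝ}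
    {P : ℕ → Matrix (Fin n) (Fin n) ℝ} (hP : ∀ k, (P k).IsSymm) (hdec : ∀ k, P (k + 1) ≤ P k)
    (hB : ∀ k, B ≤ P k) : ∃ L, Tendsto P atTop (nhds L) := by
  have h (x : Fin n → ℝ) : ∃ l, Tendsto (fun k => x ⬝ᵥ P k *ᵥ x) atTop (nhds l) := by
    refine ⟨_, tendsto_atTop_ciInf (antitone_nat_of_succ_le fun k => ?_)
      ⟨x ⬝ᵥ B *ᵥ x, ?_⟩⟩
    · exact dotProduct_mulVec_mono (hdec k) x
    · rintro _ ⟨k, rfl⟩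
      exact dotProduct_mulVec_mono (hB k) x
  choose q hq using h
  refine ⟨Matrix.of fun i j => (q (Pi.single i 1 + Pi.single j 1) - q (Pi.single i 1) -
    q (Pi.single j 1)) / 2, ?_⟩
  refine tendsto_pi_nhds.2 fun i => tendsto_pi_nhds.2 fun j => ?_
  have e : (fun k => P k i j) = fun k => _ := funext fun k => apply_eq_polarization (hP k) i j
  rw [e]
  exact (((hq _).sub (hq _)).sub (hq _)).div_const 2

theorem tendsto_inv_matrix {M : ℕ → Matrix (Fin m) (Fin m) ℝ} {L : Matrix (Fin m) (Fin m) ℝ}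
    (h : Tendsto M atTop (nhds L)) (hu : IsUnit L) :
    Tendsto (fun k => (M k)⁻¹) atTop (nhds L⁻¹) := by
  have hdet : Continuous (Matrix.det : Matrix (Fin m) (Fin m) ℝ → ℝ) := by fun_prop
  have hadj : Continuous (Matrix.adjugate : Matrix (Fin m) (Fin m) ℝ → Matrix (Fin m) (Fin m) ℝ) :=
    continuous_id.matrix_adjugate
  simp only [Matrix.inv_def, Ring.inverse_eq_inv']
  exact (((hdet.tendsto L).comp h).inv₀ ((Matrix.isUnit_iff_isUnit_det _).1 hu).ne_zero).smul
    ((hadj.tendsto L).comp h)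

theorem IsTransitionDensity.tendsto_opE (hg : IsTransitionDensity μ κ g)
    {P : ℕ → Θ → Matrix (Fin n) (Fin n) ℝ} {L : Θ → Matrix (Fin n) (Fin n) ℝ}
    (hP : ∀ k, P k ∈ HInf μ n n) (hL : L ∈ HInf μ n n) {c : ℝ}
    (hc : ∀ k, ∀ᵐ ℓ ∂μ, ‖P k ℓ‖ ≤ c)
    (h : ∀ᵐ ℓ ∂μ, Tendsto (fun k => P k ℓ) atTop (nhds (L ℓ))) (ℓ : Θ) :
    Tendsto (fun k => opE μ g (P k) ℓ) atTop (nhds (opE μ g L ℓ)) := by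
  simp only [hg.opE_eq (hP _), hg.opE_eq hL]
  have hac := (hg.absolutelyContinuous ℓ).ae_le
  exact tendsto_integral_of_dominated_convergence (fun _ => c)
    (fun k => (hg.integrable (hP k) ℓ).aestronglyMeasurable) (integrable_const c)
    (fun k => hac (hc k)) (hac h)

variable {A Q : Θ → Matrix (Fin n) (Fin n) ℝ} {G : Θ → Matrix (Fin n) (Fin m) ℝ}
  {R : Θ → Matrix (Fin m) (Fin m) ℝ}

theorem tendsto_riccatiRHS {P : ℕ → Θ → Matrix (Fin n) (Fin n) ℝ}
    {L : Θ → Matrix (Fin n) (Fin n) ℝ} {ℓ : Θ}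
    (h : Tendsto (fun k => opE μ g (P k) ℓ) atTop (nhds (opE μ g L ℓ)))
    (hu : IsUnit (opR μ g G R L ℓ)) :
    Tendsto (fun k => riccatiRHS μ g A G Q R (P k) ℓ) atTop
      (nhds (riccatiRHS μ g A G Q R L ℓ)) := by
  have hcont {r s : ℕ} (X : Matrix (Fin r) (Fin n) ℝ) (Y : Matrix (Fin n) (Fin s) ℝ) :
      Tendsto (fun k => X * opE μ g (P k) ℓ * Y) atTop (nhds (X * opE μ g L ℓ * Y)) :=
    ((by fun_prop : Continuous fun M : Matrix (Fin n) (Fin n) ℝ => X * M * Y).tendsto _).comp h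
  have hR : Tendsto (fun k => opR μ g G R (P k) ℓ) atTop (nhds (opR μ g G R L ℓ)) :=
    tendsto_const_nhds.add (hcont _ _)
  have hG : Tendsto (fun k => opG μ g A G (P k) ℓ) atTop (nhds (opG μ g A G L ℓ)) := hcont _ _
  have hA : Tendsto (fun k => opT μ g A (P k) ℓ) atTop (nhds (opT μ g A L ℓ)) := hcont _ _
  have hmul : Continuous fun q : Matrix (Fin m) (Fin n) ℝ × Matrix (Fin m) (Fin m) ℝ =>
      q.1ᵀ * q.2 * q.1 := by fun_prop
  have h3 := (hmul.tendsto (opG μ g A G L ℓ, (opR μ g G R L ℓ)⁻¹)).comp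
    (hG.prodMk_nhds (tendsto_inv_matrix hR hu))
  exact (hA.add_const (Q ℓ)).sub h3

/-- A supersolution of the Riccati equation lying above a given bounded function. -/
theorem IsTransitionDensity.exists_supersolution [SigmaFinite μ] (hg : IsTransitionDensity μ κ g)
    (hA : A ∈ HInf μ n n) (hG : G ∈ HInf μ n m) (hQ : Q ∈ SHInf μ n) (hR : R ∈ SHInf μ m)
    (hs : Stabilizable μ κ A G) {B : Θ → Matrix (Fin n) (Fin n) ℝ} (hB : B ∈ SHInf μ n)
    (hsign : SignCondition μ g G R B) :
    ∃ P ∈ SHInf μ n, (∀ᵐ ℓ ∂μ, B ℓ ≤ P ℓ) ∧ ∀ᵐ ℓ ∂μ, riccatiRHS μ g A G Q R P ℓ ≤ P ℓ := by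
  obtain ⟨K, hK, hstab⟩ := hs
  obtain ⟨V, hV, hV1, hVS⟩ := hg.exists_lyapunov (HInf.add hA (HInf.mul hG hK)) hstab
  have hM : (fun ℓ => Q ℓ + (K ℓ)ᵀ * R ℓ * K ℓ) ∈ SHInf μ n :=
    SHInf.add hQ ⟨HInf.mul (HInf.mul (HInf.transpose hK) hR.1) hK,
      hR.2.mono fun ℓ h => transpose_mul_mul_isSymm h _⟩
  obtain ⟨b, hb, hBb⟩ := exists_bound hB.1
  obtain ⟨d, hd, hMd⟩ := exists_bound hM.1
  -- As V ≥ I, the share b puts cV above B. The share d makes c(V - 𝓣(V)) ≥ cI, with 𝓣 the operator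
  -- of the closed loop under K, dominate the running cost Q + KᵀRK.
  set c := b + d
  have hc : 0 ≤ c := by positivity
  have hP : (fun ℓ => c • V ℓ) ∈ SHInf μ n := SHInf.smul hV c
  have hle : ∀ᵐ ℓ ∂μ, B ℓ ≤ c • V ℓ := by
    filter_upwards [hBb, hB.2, hV1] with ℓ h1 h2 h3
    exact (le_smul_one_of_norm_le h2 (h1.trans (by simp only [c]; linarith))).trans
      (smul_mono_right h3 hc)
  refine ⟨_, hP, hle, ?_⟩
  filter_upwards [riccatiRHS_le_gain (A := A) (Q := Q) hR hP (hg.signCondition_mono hB hP hle hsign)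
    K, hVS, hMd, hM.2] with ℓ h1 h2 h3 h4
  refine h1.trans ?_
  have h5 := le_smul_one_of_norm_le h4 (h3.trans (show d ≤ c by simp only [c]; linarith))
  have h6 := smul_mono_right h2 hc
  rw [smul_add] at h6
  rw [opT_smul, add_assoc]
  exact (add_le_add_right h5 _).trans h6

/-- Stabilizability and a point of `𝐒₊` give a solution above that point, obtained as the limit of a
decreasing value iteration. -/
theorem IsTransitionDensity.exists_solution_ge [SigmaFinite μ] (hg : IsTransitionDensity μ κ g)
    (hA : A ∈ HInf μ n n) (hG : G ∈ HInf μ n m) (hQ : Q ∈ SHInf μ n) (hR : R ∈ SHInf μ m)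
    (hs : Stabilizable μ κ A G) {B : Θ → Matrix (Fin n) (Fin n) ℝ}
    (hB : B ∈ SPlus μ g A G Q R) :
    ∃ P, IsSolution μ g A G Q R P ∧ SignCondition μ g G R P ∧ ∀ᵐ ℓ ∂μ, B ℓ ≤ P ℓ := by
  obtain ⟨hBm, hBsign, hBW⟩ := hB
  have hBF : ∀ᵐ ℓ ∂μ, B ℓ ≤ riccatiRHS μ g A G Q R B ℓ := by
    filter_upwards [hBW] with ℓ hℓ
    have := Matrix.nonneg_iff_posSemidef.2 hℓ
    rwa [opW, neg_add_eq_sub, sub_nonneg] at this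
  obtain ⟨P₀, hP₀, hBP₀, hFP₀⟩ := hg.exists_supersolution hA hG hQ hR hs hBm hBsign
  let P : ℕ → Θ → Matrix (Fin n) (Fin n) ℝ := fun k => (riccatiRHS μ g A G Q R)^[k] P₀
  have hP0 : P 0 = P₀ := rfl
  have hPsucc (k : ℕ) : P (k + 1) = riccatiRHS μ g A G Q R (P k) :=
    Function.iterate_succ_apply' _ _ _
  -- The lower bound B ≤ P k is what keeps 𝓡 uniformly positive along the iteration, so that every
  -- iterate is bounded and monotonicity applies again.
  have hind (k : ℕ) : P k ∈ SHInf μ n ∧ (∀ᵐ ℓ ∂μ, B ℓ ≤ P k ℓ) ∧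
      ∀ᵐ ℓ ∂μ, P (k + 1) ℓ ≤ P k ℓ := by
    induction k with
    | zero => exact ⟨hP₀, hBP₀, hFP₀⟩
    | succ k ih =>
      obtain ⟨h1, h2, h3⟩ := ih
      have hsk := hg.signCondition_mono hBm h1 h2 hBsign
      have hmem : P (k + 1) ∈ SHInf μ n := by
        rw [hPsucc]; exact hg.riccatiRHS_mem hA hG hQ hR h1 hsk
      have hge : ∀ᵐ ℓ ∂μ, B ℓ ≤ P (k + 1) ℓ := by
        rw [hPsucc]
        filter_upwards [hBF, hg.riccatiRHS_mono (A := A) (Q := Q) hR hBm h1 h2 hBsign]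
          with ℓ a b using a.trans b
      refine ⟨hmem, hge, ?_⟩
      rw [hPsucc (k + 1)]
      nth_rewrite 2 [hPsucc k]
      exact hg.riccatiRHS_mono hR hmem h1 h3 (hg.signCondition_mono hBm hmem hge hBsign)
  have hupper (k : ℕ) : ∀ᵐ ℓ ∂μ, P k ℓ ≤ P₀ ℓ := by
    induction k with
    | zero => exact ae_of_all _ fun _ => le_rfl
    | succ k ih => filter_upwards [ih, (hind k).2.2] with ℓ a b using b.trans a
  have hconv : ∀ᵐ ℓ ∂μ, ∃ L, Tendsto (fun k => P k ℓ) atTop (nhds L) := by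
    filter_upwards [ae_all_iff.2 fun k => (hind k).1.2, ae_all_iff.2 fun k => (hind k).2.1,
      ae_all_iff.2 fun k => (hind k).2.2] with ℓ h1 h2 h3
    exact exists_tendsto_of_antitone h1 h3 h2
  obtain ⟨L, hLm, hL⟩ := exists_stronglyMeasurable_limit_of_tendsto_ae
    (fun k => (mem_HInf_iff.1 (hind k).1.1).1.aestronglyMeasurable) hconv
  have hclosed (M : Matrix (Fin n) (Fin n) ℝ) : IsClosed {X | M ≤ X} ∧ IsClosed {X | X ≤ M} := by
    constructor
    · have h := (isClosed_nonneg (n := n)).preimage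
        (by fun_prop : Continuous fun X : Matrix (Fin n) (Fin n) ℝ => X - M)
      simpa only [Set.preimage_ofPred_eq, sub_nonneg] using h
    · have h := (isClosed_nonneg (n := n)).preimage
        (by fun_prop : Continuous fun X : Matrix (Fin n) (Fin n) ℝ => M - X)
      simpa only [Set.preimage_ofPred_eq, sub_nonneg] using h
  have hBL : ∀ᵐ ℓ ∂μ, B ℓ ≤ L ℓ := by
    filter_upwards [hL, ae_all_iff.2 fun k => (hind k).2.1] with ℓ h1 h2
    exact (hclosed (B ℓ)).1.mem_of_tendsto h1 (Eventually.of_forall h2)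
  have hLP₀ : ∀ᵐ ℓ ∂μ, L ℓ ≤ P₀ ℓ := by
    filter_upwards [hL, ae_all_iff.2 hupper] with ℓ h1 h2
    exact (hclosed (P₀ ℓ)).2.mem_of_tendsto h1 (Eventually.of_forall h2)
  have hLS : L ∈ SHInf μ n := SHInf.of_le_of_le hBm hP₀ hLm hBL hLP₀
  have hLsign := hg.signCondition_mono hBm hLS hBL hBsign
  obtain ⟨b, hb, hBb⟩ := exists_bound hBm.1
  obtain ⟨d, hd, hPd⟩ := exists_bound hP₀.1
  -- Lying between B and P₀ bounds all iterates uniformly, as dominated convergence under 𝓔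
  -- requires.
  have hbound (k : ℕ) : ∀ᵐ ℓ ∂μ, ‖P k ℓ‖ ≤ d + 2 * b := by
    filter_upwards [hBb, hPd, hBm.2, hP₀.2, (hind k).2.1, hupper k] with ℓ h1 h2 h3 h4 h5 h6
    linarith [norm_le_of_le_of_le h3 h4 h5 h6]
  refine ⟨L, ⟨hLS, hLsign.isUnit, ?_⟩, hLsign, hBL⟩
  filter_upwards [hL, hLsign.isUnit] with ℓ h1 h2
  have h3 := tendsto_riccatiRHS (A := A) (Q := Q)
    (hg.tendsto_opE (fun k => (hind k).1.1) hLS.1 hbound hL ℓ) h2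
  have h4 : Tendsto (fun k => P (k + 1) ℓ) atTop (nhds (L ℓ)) := h1.comp (tendsto_add_atTop_nat 1)
  simp only [hPsucc] at h4
  exact tendsto_nhds_unique h4 h3

end Limit

/-! ### Stabilizing and maximal solutions -/

section Solutions

variable {Θ : Type*} [MeasurableSpace Θ] {n m p : ℕ} {μ : Measure Θ} {κ : Kernel Θ Θ}
  [IsMarkovKernel κ] {g : Θ → Θ → ℝ} {A Q : Θ → Matrix (Fin n) (Fin n) ℝ}
  {G : Θ → Matrix (Fin n) (Fin m) ℝ} {R : Θ → Matrix (Fin m) (Fin m) ℝ}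
  {P P' : Θ → Matrix (Fin n) (Fin n) ℝ}

theorem opW_eq_zero (hP : IsSolution μ g A G Q R P) : ∀ᵐ ℓ ∂μ, opW μ g A G Q R P ℓ = 0 := by
  filter_upwards [hP.2.2] with ℓ h
  rw [opW, ← h, neg_add_cancel]

theorem IsSolution.mem_SPlus (hP : IsSolution μ g A G Q R P) (h : SignCondition μ g G R P) :
    P ∈ SPlus μ g A G Q R :=
  ⟨hP.1, h, (opW_eq_zero hP).mono fun _ hℓ => hℓ ▸ Matrix.PosSemidef.zero⟩

/-- Along the stable loop of P, the difference P - P' exceeds its image under 𝓣 by 𝓦(P') plus a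
square weighted by 𝓡(P'). Only 𝓡(P') has to be positive here, so the uniqueness of stabilizing
solutions needs no sign condition on them. -/
theorem IsTransitionDensity.isMaximal_of_stabilizing [SigmaFinite μ]
    (hg : IsTransitionDensity μ κ g) (hA : A ∈ HInf μ n n) (hG : G ∈ HInf μ n m)
    (hR : R ∈ SHInf μ m) (hP : IsStabilizingSolution μ κ g A G Q R P) :
    IsMaximalSolution μ g A G Q R P := by
  refine ⟨hP.1, fun P' hP' => ?_⟩
  have h := hg.nonneg_of_opT_le (HInf.add hA (HInf.mul hG hP.2.1)) hP.2.2
    (SHInf.sub hP.1.1 hP'.1) ?_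
  · exact h.mono fun ℓ hℓ => Matrix.nonneg_iff_posSemidef.1 hℓ
  · filter_upwards [hg.sub_eq_opT_sub hR hP.1 hP'.1 hP'.2.1.isUnit, hP'.2.1.nonneg, hP'.2.2]
      with ℓ h1 h2 h3
    rw [h1]
    exact le_add_of_nonneg_right (add_nonneg (Matrix.nonneg_iff_posSemidef.2 h3)
      (transpose_mul_mul_nonneg h2 _))

/-- A maximal solution is not assumed to satisfy the sign condition. P' inherits it by dominating P,
hence lies in 𝐒₊ and is dominated in turn. -/
theorem IsTransitionDensity.maximal_unique (hg : IsTransitionDensity μ κ g)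
    (hP : IsMaximalSolution μ g A G Q R P) (h : SignCondition μ g G R P)
    (hP' : IsMaximalSolution μ g A G Q R P') : P' =ᵐ[μ] P := by
  have h1 : ∀ᵐ ℓ ∂μ, P ℓ ≤ P' ℓ := hP'.2 P (hP.1.mem_SPlus h)
  have h2 : ∀ᵐ ℓ ∂μ, P' ℓ ≤ P ℓ :=
    hP.2 P' (hP'.1.mem_SPlus (hg.signCondition_mono hP.1.1 hP'.1.1 h1 h))
  filter_upwards [h1, h2] with ℓ a b using le_antisymm b a

theorem sqrtFun_mem {W : Θ → Matrix (Fin n) (Fin n) ℝ} (hW : W ∈ SHInf μ n)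
    (hW0 : ∀ᵐ ℓ ∂μ, 0 ≤ W ℓ) : sqrtFun W ∈ HInf μ n n := by
  obtain ⟨c, hc, hWc⟩ := exists_bound hW.1
  refine mem_HInf_iff.2 ⟨stronglyMeasurable_sqrt (mem_HInf_iff.1 hW.1).1, √c, ?_⟩
  filter_upwards [hWc, hW0, hW.2] with ℓ h1 h2 h3
  exact norm_sqrt_le hc h2 (le_smul_one_of_norm_le h3 h1)

theorem transpose_mul_self_le_of_norm_le {X : Matrix (Fin n) (Fin m) ℝ} {c : ℝ} (h : ‖X‖ ≤ c) :
    Xᵀ * X ≤ c ^ 2 • 1 := by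
  refine le_smul_one_of_norm_le ?_ ?_
  · simp [Matrix.IsSymm, Matrix.transpose_mul]
  · rw [← Matrix.conjTranspose_eq_transpose_of_trivial, Matrix.l2_opNorm_conjTranspose_mul_self,
      ← sq]
    gcongr

theorem transpose_mul_mul_self_le {H : Matrix (Fin n) (Fin m) ℝ} {c : ℝ} (h : ‖H‖ ≤ c)
    (X : Matrix (Fin m) (Fin p) ℝ) : (H * X)ᵀ * (H * X) ≤ c ^ 2 • (Xᵀ * X) := by
  have := transpose_mul_mul_mono (transpose_mul_self_le_of_norm_le h) X
  simpa [Matrix.transpose_mul, Matrix.mul_assoc] using this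

theorem IsTransitionDensity.expStabilizes_of_detectable [SigmaFinite μ]
    (hg : IsTransitionDensity μ κ g)
    (hA : A ∈ HInf μ n n) (hG : G ∈ HInf μ n m) (hQ : Q ∈ SHInf μ n) (hR : R ∈ SHInf μ m)
    (hP' : P' ∈ SPlus μ g A G Q R)
    (hdet : Detectable μ κ (fun ℓ => A ℓ + G ℓ * opM μ g A G R P' ℓ)
      (sqrtFun (opW μ g A G Q R P')))
    (hP : IsSolution μ g A G Q R P) (hsign : SignCondition μ g G R P)
    (hle : ∀ᵐ ℓ ∂μ, P' ℓ ≤ P ℓ) : ExpStabilizes μ κ A G (opM μ g A G R P) := by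
  obtain ⟨H, hH, hstab⟩ := hdet
  obtain ⟨ξ, hξ, hξR⟩ := hP'.2.1.exists_le
  have hM := hg.opM_mem hA hG hR hP.1 hsign
  have hM' := hg.opM_mem hA hG hR hP'.1 hP'.2.1
  have hW := hg.opW_mem hA hG hQ hR hP'.1 hP'.2.1
  have hW0 : ∀ᵐ ℓ ∂μ, 0 ≤ opW μ g A G Q R P' ℓ :=
    hP'.2.2.mono fun ℓ h => Matrix.nonneg_iff_posSemidef.2 h
  refine ⟨hM, ?_⟩
  obtain ⟨a, ha, hHa⟩ := exists_bound hH
  obtain ⟨b, hb, hGb⟩ := exists_bound hG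
  -- The factors 2 come from splitting H√W - GD with ε = 1; a² and b² bound H and G, and ξ⁻¹
  -- converts DᵀD into Dᵀ𝓡(P')D.
  set c := 2 * a ^ 2 + 2 * (b ^ 2 * ξ⁻¹)
  have hc : 0 ≤ c := by positivity
  refine hg.EMSS_of_decrease (HInf.add hA (HInf.mul hG hM))
    (HInf.add (HInf.add hA (HInf.mul hG hM')) (HInf.mul hH (sqrtFun_mem hW hW0))) hstab
    (SHInf.sub hP.1 hP'.1) (hle.mono fun _ h => sub_nonneg.2 h) hc ?_
  filter_upwards [hg.sub_eq_opT_sub hR hP hP'.1 hP'.2.1.isUnit, hW0, hξR, hHa, hGb]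
    with ℓ h1 h2 h3 h4 h5
  rw [sub_eq_iff_eq_add'.2 h1]
  set D := opM μ g A G R P ℓ - opM μ g A G R P' ℓ
  set W := opW μ g A G Q R P' ℓ
  set E := opR μ g G R P' ℓ
  have e1 : A ℓ + G ℓ * opM μ g A G R P' ℓ + H ℓ * sqrtFun (opW μ g A G Q R P') ℓ -
      (A ℓ + G ℓ * opM μ g A G R P ℓ) = H ℓ * CFC.sqrt W - G ℓ * D := by
    simp only [D, Matrix.mul_sub, sqrtFun, W]
    abel
  rw [e1]
  have h6 := transpose_sub_mul_mul_le (zero_le_one (α := Matrix (Fin n) (Fin n) ℝ))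
    (H ℓ * CFC.sqrt W) (G ℓ * D) one_pos
  simp only [Matrix.mul_one] at h6
  have h7 : (H ℓ * CFC.sqrt W)ᵀ * (H ℓ * CFC.sqrt W) ≤ a ^ 2 • W := by
    have := transpose_mul_mul_self_le h4 (CFC.sqrt W)
    rwa [sqrt_transpose_mul_self h2] at this
  have h8 : Dᵀ * D ≤ ξ⁻¹ • (Dᵀ * E * D) := by
    have := smul_mono_right (transpose_mul_mul_mono h3 D) (inv_nonneg.2 hξ.le)
    rwa [Matrix.mul_smul, Matrix.smul_mul, Matrix.mul_one, smul_smul, inv_mul_cancel₀ hξ.ne',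
      one_smul] at this
  have h9 : (G ℓ * D)ᵀ * (G ℓ * D) ≤ (b ^ 2 * ξ⁻¹) • (Dᵀ * E * D) := by
    have := smul_mono_right h8 (sq_nonneg b)
    rw [smul_smul] at this
    exact (transpose_mul_mul_self_le h5 D).trans this
  have hE : 0 ≤ Dᵀ * E * D := by
    refine transpose_mul_mul_nonneg (le_trans ?_ h3) D
    simpa using smul_mono_right (zero_le_one (α := Matrix (Fin m) (Fin m) ℝ)) hξ.le
  refine h6.trans ?_
  rw [inv_one, one_add_one_eq_two, smul_add]
  refine add_le_add ((smul_mono_right h7 zero_le_two).trans ?_)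
    ((smul_mono_right h9 zero_le_two).trans ?_)
  · rw [smul_smul]
    exact smul_mono_left h2 (by simp only [c]; linarith [show 0 ≤ b ^ 2 * ξ⁻¹ by positivity])
  · rw [smul_smul]
    exact smul_mono_left hE (by simp only [c]; linarith [sq_nonneg a])

theorem IsTransitionDensity.exists_stabilizing [SigmaFinite μ] (hg : IsTransitionDensity μ κ g)
    (hA : A ∈ HInf μ n n) (hG : G ∈ HInf μ n m) (hQ : Q ∈ SHInf μ n) (hR : R ∈ SHInf μ m)
    (h : StabDetectCondition μ κ g A G Q R) :
    ∃ P, IsStabilizingSolution μ κ g A G Q R P ∧ SignCondition μ g G R P := by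
  obtain ⟨hs, P', hP', hdet⟩ := h
  obtain ⟨P, hP, hsign, hle⟩ := hg.exists_solution_ge hA hG hQ hR hs hP'
  exact ⟨P, ⟨hP, hg.expStabilizes_of_detectable hA hG hQ hR hP' hdet hP hsign hle⟩, hsign⟩

theorem IsStabilizingSolution.stabDetectCondition
    (hP : IsStabilizingSolution μ κ g A G Q R P) (hsign : SignCondition μ g G R P) :
    StabDetectCondition μ κ g A G Q R := by
  -- The loop A + G𝓜(P) is already stable, so the zero output injection works.
  refine ⟨⟨_, hP.2⟩, P, hP.1.mem_SPlus hsign, fun _ => 0, HInf.const 0, ?_⟩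
  simpa using hP.2.2

end Solutions

end

end MJLS

/-! ### The equivalence, and the coincidence of the maximal and stabilizing solutions. -/

theorem theorem5 {Θ : Type*} [MeasurableSpace Θ] [StandardBorelSpace Θ]
    (μ : Measure Θ) [SigmaFinite μ]
    (κ : Kernel Θ Θ) [IsMarkovKernel κ]
    (g : Θ → Θ → ℝ) (hg_nonneg : ∀ ℓ t, 0 ≤ g ℓ t) (hg_meas : ∀ ℓ, Measurable (g ℓ))
    (hg : ∀ (ℓ : Θ) (Λ : Set Θ), MeasurableSet Λ →
      κ ℓ Λ = ∫⁻ t in Λ, ENNReal.ofReal (g ℓ t) ∂μ)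
    {n m : ℕ}
    (A : Θ → Matrix (Fin n) (Fin n) ℝ) (hA : A ∈ MJLS.HInf μ n n)
    (G : Θ → Matrix (Fin n) (Fin m) ℝ) (hG : G ∈ MJLS.HInf μ n m)
    (Q : Θ → Matrix (Fin n) (Fin n) ℝ) (hQ : Q ∈ MJLS.SHInf μ n)
    (R : Θ → Matrix (Fin m) (Fin m) ℝ) (hR : R ∈ MJLS.SHInf μ m)
    (hR_pos : MJLS.AEUniformPos μ R) :
    (MJLS.StabDetectCondition μ κ g A G Q R ↔
      ∃ P, MJLS.IsStabilizingSolution μ κ g A G Q R P ∧ MJLS.SignCondition μ g G R P) ∧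
    (MJLS.StabDetectCondition μ κ g A G Q R →
      ∃ P, MJLS.IsMaximalSolution μ g A G Q R P ∧
        MJLS.IsStabilizingSolution μ κ g A G Q R P ∧
        MJLS.SignCondition μ g G R P ∧
        (∀ P', MJLS.IsMaximalSolution μ g A G Q R P' → P' =ᵐ[μ] P) ∧
        (∀ P', MJLS.IsStabilizingSolution μ κ g A G Q R P' → P' =ᵐ[μ] P)) := by

  have hd : MJLS.IsTransitionDensity μ κ g := ⟨hg_nonneg, hg_meas, hg⟩
  refine ⟨⟨hd.exists_stabilizing hA hG hQ hR, fun ⟨P, hP, hsign⟩ => hP.stabDetectCondition hsign⟩,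
    fun h => ?_⟩
  obtain ⟨P, hP, hsign⟩ := hd.exists_stabilizing hA hG hQ hR h
  have hmax := hd.isMaximal_of_stabilizing hA hG hR hP
  -- Any stabilizing solution is maximal, so both uniqueness claims reduce to that of maximal
  -- solutions.
  exact ⟨P, hmax, hP, hsign, fun P' hP' => hd.maximal_unique hmax hsign hP',
    fun P' hP' => hd.maximal_unique hmax hsign (hd.isMaximal_of_stabilizing hA hG hR hP')⟩
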